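/- Let $H$ be a Hermitian operator on $\mathbb{C}^D$ ($D\ge 1$), let $\beta\in\mathbb{R}$, and let $\sigma_\beta = e^{-\beta H}/\operatorname{Tr}(e^{-\beta H})$. Let $\{|j\rangle\}_{j=1}^D$ be an arbitrary orthonormal basis and let $\xi_1,\dots,\xi_D$ be independent circularly symmetric complex Gaussian variables with mean zero and common variance $v>0$. The canonical thermal pure quantum ensemble $\mathcal{E}_{\mathrm{cTPQ}}$ is the law of the random unit vector $$\frac{1}{\mathcal{N}}\sum_{j=1}^D \xi_j\, e^{-\beta H/2}|j\rangle,\qquad \mathcal N=\Big\|\sum_{j=1}^D \xi_j\, e^{-\beta H/2}|j\rangle\Big\|.$$ For a density matrix $\sigma$ on $\mathbb{C}^D$, the ensemble $\mathrm{Scrooge}(\sigma)$ is the law of $\sqrt{\sigma}|\phi\rangle/\|\sqrt{\sigma}|\phi\rangle\|$, where $|\phi\rangle$ has density $D\langle\phi|\sigma|\phi\rangle$ with respect to the Haar (uniform) probability measure on the unit sphere of $\mathbb{C}^D$. For an ensemble $\mathcal{E}$ of pure states write $\rho^{(k)}_{\mathcal{E}} = \mathbb{E}_{\psi\sim\mathcal{E}}\,(|\psi\rangle\langle\psi|)^{\otimes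 k}$; $\mathcal{E}$ is a $\mathrm{Scrooge}(\sigma)$ $k$-design with relative error $\epsilon$ if $$(1-\epsilon)\,\rho^{(k)}_{\mathrm{Scrooge}(\sigma)} \preceq \rho^{(k)}_{\mathcal{E}} \preceq (1+\epsilon)\,\rho^{(k)}_{\mathrm{Scrooge}(\sigma)}$$ in the Loewner order. Let $\|A\|_2=\sqrt{\operatorname{Tr}(A^\dagger A)}$. Then there are absolute constants $c,C>0$ and constants $K_k$ depending only on $k$ such that for all $D\ge 1$, $k\in\mathbb{N}$, Hermitian $H$, $\beta\in\mathbb{R}$, $v>0$ and every orthonormal basis as above with $$k^2\,\|\sigma_\beta\|_2\le c,$$ the ensemble $\mathcal{E}_{\mathrm{cTPQ}}$ is a $\mathrm{Scrooge}(\sigma_\beta)$ $k$-design with a relative error $\epsilon$ satisfying $$1+\epsilon=(1+\delta)^2\quad\text{for some } 0\le\delta\le C\,4^k k\,\|\sigma_\beta\|_2,$$ and moreover $\epsilon\le K_k\,4^k k\,\|\sigma_\beta\|_2$. -/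

import Mathlib

open MeasureTheory ProbabilityTheory
open scoped NNReal ComplexOrder

noncomputable section

namespace Scrooge

/-- The `D`-dimensional Hilbert space `ℂ^D` with its standard inner product. -/
abbrev Hilb (D : ℕ) : Type := EuclideanSpace ℂ (Fin D)

/-- The action of a matrix on vectors of `ℂ^D`. -/
def act {D : ℕ} (A : Matrix (Fin D) (Fin D) ℂ) (ψ : Hilb D) : Hilb D :=
  Matrix.toEuclideanLin A ψ

/-- The normalization `ψ / ‖ψ‖` of a vector (the zero vector is sent to itself). -/
def unitVector {D : ℕ} (ψ : Hilb D) : Hilb D := (‖ψ‖⁻¹ : ℝ) • ψ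

/-- The Haar probability measure on the unit sphere of `ℂ^D`: the surface measure
of the sphere, divided by its total mass. -/
def haarSphere (D : ℕ) : Measure (Metric.sphere (0 : Hilb D) 1) :=
  ((volume : Measure (Hilb D)).toSphere Set.univ)⁻¹ • (volume : Measure (Hilb D)).toSphere

/-- The operator `(|ψ⟩⟨ψ|)^{⊗ k}` on `(ℂ^D)^{⊗ k}`, as a matrix in the product basis, which is
indexed by the maps `Fin k → Fin D`. -/
def projTensor {D : ℕ} (k : ℕ) (ψ : Hilb D) :
    Matrix (Fin k → Fin D) (Fin k → Fin D) ℂ :=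
  fun i j => ∏ a, ψ (i a) * star (ψ (j a))

/-- The `k`-th moment `𝔼_{ψ ∼ 𝓔} (|ψ⟩⟨ψ|)^{⊗ k}` of an ensemble, given by the law of its state
vector; the expectation is taken entrywise. -/
def moment {D : ℕ} (k : ℕ) (E : Measure (Hilb D)) :
    Matrix (Fin k → Fin D) (Fin k → Fin D) ℂ :=
  fun i j => ∫ ψ, projTensor k ψ i j ∂E

/-- A measure on `ℂ^D` is an ensemble of pure states if it is a probability measure that is
carried by the unit vectors. -/
def IsPureEnsemble {D : ℕ} (E : Measure (Hilb D)) : Prop :=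
  IsProbabilityMeasure E ∧ ∀ᵐ ψ ∂E, ‖ψ‖ = 1

/-- The Scrooge ensemble of a density matrix `σ`: the law of `√σ|φ⟩ / ‖√σ|φ⟩‖`, where `|φ⟩` on
the unit sphere has density `D ⟨φ|σ|φ⟩` with respect to the Haar measure. -/
def scroogeEnsemble {D : ℕ} (σ : Matrix (Fin D) (Fin D) ℂ) : Measure (Hilb D) :=
  ((haarSphere D).withDensity
      fun φ => ENNReal.ofReal (D * (inner ℂ (φ : Hilb D) (act σ φ)).re)).map
    fun φ : Metric.sphere (0 : Hilb D) 1 => unitVector (act (cfc Real.sqrt σ) φ)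

/-- `E` is a Scrooge(`σ`) `k`-design with relative error `ε`:
`(1 - ε) ρ_Scrooge ⪯ ρ_E ⪯ (1 + ε) ρ_Scrooge` for the `k`-th moments, in the Loewner order. -/
def IsRelScroogeDesign {D : ℕ} (k : ℕ) (σ : Matrix (Fin D) (Fin D) ℂ) (ε : ℝ)
    (E : Measure (Hilb D)) : Prop :=
  IsPureEnsemble E ∧
  (moment k E - (1 - ε) • moment k (scroogeEnsemble σ)).PosSemidef ∧
  ((1 + ε) • moment k (scroogeEnsemble σ) - moment k E).PosSemidef

/-- The Schatten 2-norm `√(Tr(A† A))`. -/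
def schattenTwo {D : ℕ} (A : Matrix (Fin D) (Fin D) ℂ) : ℝ :=
  Real.sqrt (A.conjTranspose * A).trace.re

/-- The thermal Gibbs state `exp(-βH) / Tr exp(-βH)`. -/
def gibbs {D : ℕ} (H : Matrix (Fin D) (Fin D) ℂ) (β : ℝ) : Matrix (Fin D) (Fin D) ℂ :=
  (NormedSpace.exp ((-β) • H)).trace⁻¹ • NormedSpace.exp ((-β) • H)

/-- The zero-mean (circularly symmetric) complex Gaussian law of variance `v`: real and imaginary
part are independent real Gaussian variables with mean `0` and variance `v / 2`. -/
def complexGaussian (v : ℝ≥0) : Measure ℂ :=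
  ((gaussianReal 0 (v / 2)).prod (gaussianReal 0 (v / 2))).map fun p => (⟨p.1, p.2⟩ : ℂ)

/-- The canonical thermal pure quantum ensemble: the law of the normalization of
`∑ j, ξ_j exp(-βH/2)|j⟩`, where `|j⟩` is the orthonormal basis `b` and the `ξ_j` are independent
zero-mean complex Gaussian variables of variance `v`. -/
def cTPQ {D : ℕ} (H : Matrix (Fin D) (Fin D) ℂ) (β : ℝ) (v : ℝ≥0)
    (b : OrthonormalBasis (Fin D) ℂ (Hilb D)) : Measure (Hilb D) :=
  (Measure.pi fun _ : Fin D => complexGaussian v).map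
    fun ξ => unitVector (∑ j, ξ j • act (NormedSpace.exp ((-β / 2) • H)) (b j))

end Scrooge

end

/-!
Let `s = ‖σ‖₂`, where `σ` is the Gibbs state. The direction of a Gaussian vector is Haar distributed
(`map_unitVector_gaussian`), so the thermal ensemble and the Scrooge ensemble are the images under the
same map `φ ↦ √σ φ / ‖√σ φ‖` of the Haar measure and of the measure with density `D X`, where
`X φ = ⟨φ, σ φ⟩`. Testing the `k`-th moments against a vector, one has to compare `∫ h` and
`∫ D X h` over the sphere, where `h = |p|² / X ^ k` for a form `p` of degree `k`. As `h` is homogeneous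
of degree `0`, polar coordinates turn both into integrals against the Gaussian weight
`γ = exp (-‖z‖²)`, in coordinates in which `σ` is diagonal with eigenvalues `lam i ≤ s` of sum `1`.

There, `|∫ X h γ - ∫ h γ| ≤ k s ∫ h γ` (`sub_mul_integral_ratio_le`, `integral_ratio_le_add_mul`).
The linear change of variables `z_i ↦ z_i / √(1 + t lam i)` gives
`∫ h exp (-t X) γ = ∏ i, (1 + t lam i)⁻¹ * ∫ h (S z) γ`, and `exp (-t X) ≥ 1 - t X`, so it is enough to
bound `∫ h (S z) γ` by `(1 + k s |t| + o(t)) ∫ h γ` as `t → 0` from either side. Here the denominator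
changes by at most the obvious factor, and so does the numerator after integration
(`integral_weight_tensorForm_scale_le`): integrals against a phase invariant weight do not see cross
terms between monomials on which the diagonal map `S` acts by different factors.

Hence `(1 - k s) ρ_cTPQ ≤ ρ_Scrooge ≤ (1 + k s) ρ_cTPQ`, and `k s ≤ k² s ≤ 1/2` allows inverting
these inequalities with a relative error of order `k s`.
-/

namespace Scrooge

/-! ### Change of variables, polar coordinates and Gaussian vectors -/

theorem act_apply {D : ℕ} (A : Matrix (Fin D) (Fin D) ℂ) (z : Hilb D) (i : Fin D) :
    act A z i = ∑ j, A i j * z j := by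
  simp [act, Matrix.toLpLin_apply, Matrix.mulVec, dotProduct]

theorem continuous_act {D : ℕ} (A : Matrix (Fin D) (Fin D) ℂ) : Continuous (act A) :=
  LinearMap.continuous_of_finiteDimensional (Matrix.toEuclideanLin A)

theorem act_smul_real {D : ℕ} (A : Matrix (Fin D) (Fin D) ℂ) (r : ℝ) (z : Hilb D) :
    act A (r • z) = r • act A z := by
  exact ((Matrix.toEuclideanLin A).restrictScalars ℝ).map_smul r z

theorem act_mul {D : ℕ} (A B : Matrix (Fin D) (Fin D) ℂ) (z : Hilb D) :
    act (A * B) z = act A (act B z) := by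
  simp [act, Matrix.toLpLin_apply, Matrix.mulVec_mulVec]

theorem act_one {D : ℕ} (z : Hilb D) : act (1 : Matrix (Fin D) (Fin D) ℂ) z = z := by
  simp [act]

/-- The Jacobian of a complex linear map, seen as a real linear map, is `|det A|²`. -/
theorem integral_comp_act {D : ℕ} {A : Matrix (Fin D) (Fin D) ℂ} (hA : A.det ≠ 0)
    {E : Type*} [NormedAddCommGroup E] [NormedSpace ℝ E] (F : Hilb D → E) :
    ∫ z, F (act A z) = (‖A.det‖ ^ 2)⁻¹ • ∫ z, F z := by
  have hdet : LinearMap.det ((Matrix.toEuclideanLin A).restrictScalars ℝ) = ‖A.det‖ ^ 2 := by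
    rw [LinearMap.det_restrictScalars, LinearMap.det_toLpLin,
      Algebra.norm_complex_apply, Complex.normSq_eq_norm_sq]
  have hne : LinearMap.det ((Matrix.toEuclideanLin A).restrictScalars ℝ) ≠ 0 := by
    rw [hdet]; exact pow_ne_zero _ (norm_ne_zero_iff.2 hA)
  have hinj : Function.Injective (act A) := by
    intro x y hxy
    have h := congrArg (act A⁻¹) hxy
    simpa [← act_mul, Matrix.nonsing_inv_mul A (isUnit_iff_ne_zero.2 hA), act_one] using h
  have hme : MeasurableEmbedding (act A) := (continuous_act A).measurableEmbedding hinj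
  have hmap := Measure.map_linearMap_addHaar_eq_smul_addHaar (volume : Measure (Hilb D)) hne
  rw [← hme.integral_map F]
  change ∫ y, F y ∂(Measure.map ((Matrix.toEuclideanLin A).restrictScalars ℝ) volume) = _
  rw [hmap, integral_smul_measure, hdet, ENNReal.toReal_ofReal (abs_nonneg _),
    abs_of_nonneg (by positivity)]

theorem measurable_unitVector {D : ℕ} : Measurable (unitVector : Hilb D → Hilb D) := by
  unfold unitVector; fun_prop

theorem norm_unitVector {D : ℕ} {z : Hilb D} (hz : z ≠ 0) : ‖unitVector z‖ = 1 := by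
  simp [unitVector, norm_smul, norm_ne_zero_iff.2 hz]

theorem unitVector_smul {D : ℕ} {r : ℝ} (hr : 0 < r) (z : Hilb D) :
    unitVector (r • z) = unitVector z := by
  rw [unitVector, unitVector, norm_smul, smul_smul, Real.norm_of_nonneg hr.le, mul_inv,
    mul_right_comm, inv_mul_cancel₀ hr.ne', one_mul]

/-- Polar coordinates for a product of a function of the direction and a function of the norm. -/
theorem lintegral_polar {D : ℕ} [NeZero D] {F : Hilb D → ENNReal} (hF : Measurable F)
    {ρ : ℝ → ENNReal} (hρ : Measurable ρ) :
    ∫⁻ x, F (unitVector x) * ρ ‖x‖ =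
      (∫⁻ φ, F (φ : Hilb D) ∂(volume : Measure (Hilb D)).toSphere) *
        ∫⁻ r, ρ r ∂(Measure.volumeIoiPow (Module.finrank ℝ (Hilb D) - 1)) := by
  have h := (volume : Measure (Hilb D)).measurePreserving_homeomorphUnitSphereProd
  rw [← lintegral_prod_mul (by fun_prop) (by fun_prop),
    ← h.lintegral_comp_emb (Homeomorph.measurableEmbedding _)]
  conv_lhs => rw [← restrict_compl_singleton (μ := (volume : Measure (Hilb D))) 0]
  rw [← lintegral_subtype_comap (measurableSet_singleton _).compl]
  simp [unitVector]

/-- Polar coordinates for a product of a function of the direction and a function of the norm. -/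
theorem integral_polar {D : ℕ} [NeZero D] (F : Hilb D → ℝ) (ρ : ℝ → ℝ) :
    ∫ x, F (unitVector x) * ρ ‖x‖ =
      (∫ φ, F (φ : Hilb D) ∂(volume : Measure (Hilb D)).toSphere) *
        ∫ r, ρ r ∂(Measure.volumeIoiPow (Module.finrank ℝ (Hilb D) - 1)) := by
  have h := (volume : Measure (Hilb D)).measurePreserving_homeomorphUnitSphereProd
  rw [← integral_prod_mul (fun φ : Metric.sphere (0 : Hilb D) 1 => F φ)
    (fun r : Set.Ioi (0 : ℝ) => ρ r), ← h.integral_comp (Homeomorph.measurableEmbedding _)]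
  conv_lhs => rw [← restrict_compl_singleton (μ := (volume : Measure (Hilb D))) 0]
  rw [← integral_subtype_comap (measurableSet_singleton _).compl
    (fun x : Hilb D => F (unitVector x) * ρ ‖x‖)]
  simp [unitVector]

/-- A product of measures with densities has the product density. -/
theorem pi_withDensity {ι α : Type*} [Fintype ι] [MeasurableSpace α] (μ : Measure α)
    [SigmaFinite μ] {f : α → ℝ} (hf : Integrable f μ) (hf0 : ∀ x, 0 ≤ f x) :
    Measure.pi (fun _ : ι => μ.withDensity fun x => ENNReal.ofReal (f x)) =
      (Measure.pi fun _ : ι => μ).withDensity fun x => ENNReal.ofReal (∏ i, f (x i)) := by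
  have : IsFiniteMeasure (μ.withDensity fun x => ENNReal.ofReal (f x)) :=
    isFiniteMeasure_withDensity_ofReal hf.2
  refine (Measure.pi_eq fun s hs => ?_)
  rw [withDensity_apply _ (MeasurableSet.univ_pi hs),
    ← lintegral_indicator (MeasurableSet.univ_pi hs)]
  have h1 : ∀ x : ι → α, (Set.univ.pi s).indicator (fun x => ENNReal.ofReal (∏ i, f (x i))) x
      = ENNReal.ofReal (∏ i, (s i).indicator f (x i)) := by
    intro x
    by_cases hx : x ∈ Set.univ.pi s
    · rw [Set.indicator_of_mem hx]
      congr 1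
      exact Finset.prod_congr rfl fun i _ => (Set.indicator_of_mem (hx i trivial) f).symm
    · rw [Set.indicator_of_notMem hx]
      simp only [Set.mem_pi, Set.mem_univ, true_implies, not_forall] at hx
      obtain ⟨i, hi⟩ := hx
      rw [Finset.prod_eq_zero (Finset.mem_univ i) (Set.indicator_of_notMem hi f)]
      simp
  have h0 : ∀ i x, 0 ≤ (s i).indicator f x := fun i x =>
    Set.indicator_nonneg (fun x _ => hf0 x) x
  simp_rw [h1]
  rw [← ofReal_integral_eq_lintegral_ofReal
      (Integrable.fintype_prod fun i => hf.indicator (hs i))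
      (Filter.Eventually.of_forall fun x => Finset.prod_nonneg fun i _ => h0 i _),
    integral_fintype_prod_eq_prod,
    ENNReal.ofReal_prod_of_nonneg fun i _ => integral_nonneg (h0 i)]
  refine Finset.prod_congr rfl fun i _ => ?_
  rw [withDensity_apply _ (hs i), integral_indicator (hs i),
    ofReal_integral_eq_lintegral_ofReal hf.integrableOn
      (Filter.Eventually.of_forall fun x => hf0 x)]

theorem complexGaussian_eq_withDensity {v : ℝ≥0} (hv : v ≠ 0) :
    complexGaussian v = (volume : Measure ℂ).withDensity
      fun z => ENNReal.ofReal ((√(Real.pi * v))⁻¹ ^ 2 * Real.exp (-‖z‖ ^ 2 / v)) := by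
  have hv' : (v : ℝ) ≠ 0 := by exact_mod_cast hv
  have hv2 : v / 2 ≠ 0 := div_ne_zero hv two_ne_zero
  rw [complexGaussian, gaussianReal_of_var_ne_zero _ hv2,
    prod_withDensity (measurable_gaussianPDF _ _) (measurable_gaussianPDF _ _)]
  have hmp := Complex.volume_preserving_equiv_real_prod
  have hfun : (fun p : ℝ × ℝ => (⟨p.1, p.2⟩ : ℂ)) = Complex.measurableEquivRealProd.symm := by
    ext p : 1; simp [Complex.measurableEquivRealProd_symm_apply]
  rw [hfun]
  ext s hs
  rw [MeasurableEquiv.map_apply, withDensity_apply _ (Complex.measurableEquivRealProd.symm.measurable hs),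
    withDensity_apply _ hs]
  rw [← hmp.symm.setLIntegral_comp_preimage_emb
    (Complex.measurableEquivRealProd.symm.measurableEmbedding)]
  refine lintegral_congr fun p => ?_
  rw [gaussianPDF, gaussianPDF, ← ENNReal.ofReal_mul (gaussianPDFReal_nonneg _ _ _)]
  congr 1
  rw [gaussianPDFReal, gaussianPDFReal, mul_mul_mul_comm, ← Real.exp_add, ← Complex.normSq_eq_norm_sq,
    Complex.normSq_apply, ← pow_two]
  simp only [Complex.measurableEquivRealProd_symm_apply, NNReal.coe_div, NNReal.coe_ofNat, sub_zero]
  have e1 : 2 * Real.pi * ((v : ℝ) / 2) = Real.pi * v := by ring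
  rw [e1]
  have e2 : -p.1 ^ 2 / (2 * ((v : ℝ) / 2)) + -p.2 ^ 2 / (2 * (v / 2))
      = -(p.1 * p.1 + p.2 * p.2) / v := by field_simp; ring
  rw [e2]

instance isProbabilityMeasure_complexGaussian (v : ℝ≥0) :
    IsProbabilityMeasure (complexGaussian v) := by
  unfold complexGaussian
  refine Measure.isProbabilityMeasure_map (Measurable.aemeasurable ?_)
  exact Complex.measurableEquivRealProd.symm.measurable

theorem toSphere_univ_ne_zero (D : ℕ) [NeZero D] :
    (volume : Measure (Hilb D)).toSphere Set.univ ≠ 0 := by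
  rw [Measure.measure_univ_ne_zero]
  exact Measure.toSphere_ne_zero _

instance isProbabilityMeasure_haarSphere (D : ℕ) [NeZero D] :
    IsProbabilityMeasure (haarSphere D) := by
  refine ⟨?_⟩
  rw [haarSphere, Measure.smul_apply, smul_eq_mul]
  exact ENNReal.inv_mul_cancel (toSphere_univ_ne_zero D) (measure_ne_top _ _)

/-- The direction of a complex Gaussian vector with independent coordinates of equal variance, in
any orthonormal basis, is Haar distributed: the product density depends on the norm only, so polar
coordinates factor it out, and the remaining constant is fixed by normalization. -/
theorem map_unitVector_gaussian {D : ℕ} [NeZero D] {v : ℝ≥0} (hv : v ≠ 0)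
    (b : OrthonormalBasis (Fin D) ℂ (Hilb D)) :
    (Measure.pi fun _ : Fin D => complexGaussian v).map
      (fun ξ => unitVector (∑ j, ξ j • b j)) = (haarSphere D).map (↑) := by
  let L : (Fin D → ℂ) ≃L[ℝ] Hilb D :=
    (((WithLp.linearEquiv 2 ℂ (Fin D → ℂ)).symm.trans
      b.repr.symm.toLinearEquiv).restrictScalars ℝ).toContinuousLinearEquiv
  have hL : ∀ ξ, L ξ = ∑ j, ξ j • b j := fun ξ => by
    rw [b.sum_repr_symm]; rfl
  have hLn : ∀ ξ, ‖L ξ‖ ^ 2 = ∑ j, ‖ξ j‖ ^ 2 := fun ξ => by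
    have : L ξ = b.repr.symm (WithLp.toLp 2 ξ) := rfl
    rw [this, LinearIsometryEquiv.norm_map, EuclideanSpace.norm_sq_eq]
  -- the value of `c` is irrelevant, it drops out by normalization
  obtain ⟨c, hc⟩ : ∃ c : ENNReal, (volume : Measure (Fin D → ℂ)).map L = c • volume := by
    have := L.isAddHaarMeasure_map (volume : Measure (Fin D → ℂ))
    exact ⟨(Measure.addHaarScalarFactor _ volume : ℝ≥0), Measure.isAddLeftInvariant_eq_smul _ _⟩
  let K : ℝ := (√(Real.pi * v))⁻¹ ^ 2
  let f : ℂ → ℝ := fun z => K * Real.exp (-‖z‖ ^ 2 / v)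
  have hf0 : ∀ z, 0 ≤ f z := fun z => by positivity
  have hfm : Measurable f := by fun_prop
  have hfi : Integrable f := by
    refine ⟨hfm.aestronglyMeasurable, ?_⟩
    rw [hasFiniteIntegral_iff_ofReal (Filter.Eventually.of_forall hf0)]
    have h : complexGaussian v Set.univ < ⊤ := measure_lt_top _ _
    rwa [complexGaussian_eq_withDensity hv, withDensity_apply _ MeasurableSet.univ,
      Measure.restrict_univ] at h
  let ρ : ℝ → ENNReal := fun r => ENNReal.ofReal (K ^ D * Real.exp (-r ^ 2 / v))
  have hρ : Measurable ρ := by fun_prop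
  have hfρ : ∀ ξ : Fin D → ℂ, ENNReal.ofReal (∏ i, f (ξ i)) = ρ ‖L ξ‖ := fun ξ => by
    simp only [f, ρ]
    rw [Finset.prod_mul_distrib, Finset.prod_const, ← Real.exp_sum, hLn, Finset.card_univ,
      Fintype.card_fin, neg_div, Finset.sum_div, ← Finset.sum_neg_distrib]
    simp_rw [neg_div]
  have hLm : Measurable L := L.continuous.measurable
  have hpm : Measurable fun ξ : Fin D → ℂ => ENNReal.ofReal (∏ i, f (ξ i)) :=
    (Finset.measurable_prod _ fun i _ => hfm.comp (measurable_pi_apply i)).ennreal_ofReal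
  simp_rw [← hL]
  have hmeas : Measurable fun ξ => unitVector (L ξ) := measurable_unitVector.comp hLm
  have hval : Measurable ((↑) : Metric.sphere (0 : Hilb D) 1 → Hilb D) := measurable_subtype_coe
  have key : (Measure.pi fun _ : Fin D => complexGaussian v).map (fun ξ => unitVector (L ξ)) =
      (c * ∫⁻ r, ρ r ∂(Measure.volumeIoiPow (Module.finrank ℝ (Hilb D) - 1))) •
        (volume : Measure (Hilb D)).toSphere.map (↑) := by
    ext s hs
    have hF : Measurable (s.indicator (1 : Hilb D → ENNReal)) := measurable_one.indicator hs
    rw [← lintegral_indicator_one hs, lintegral_map hF hmeas,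
      complexGaussian_eq_withDensity hv, pi_withDensity _ hfi hf0,
      lintegral_withDensity_eq_lintegral_mul _ hpm
        (g := fun ξ => s.indicator (1 : Hilb D → ENNReal) (unitVector (L ξ))) (hF.comp hmeas),
      ← volume_pi]
    simp only [Pi.mul_apply]
    rw [show (∫⁻ ξ : Fin D → ℂ, ENNReal.ofReal (∏ i, f (ξ i)) *
          s.indicator (1 : Hilb D → ENNReal) (unitVector (L ξ))) =
        ∫⁻ ξ, (fun z => s.indicator (1 : Hilb D → ENNReal) (unitVector z) * ρ ‖z‖) (L ξ) from
        lintegral_congr fun ξ => by rw [hfρ, mul_comm]]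
    rw [← lintegral_map (f := fun z => s.indicator (1 : Hilb D → ENNReal) (unitVector z) * ρ ‖z‖)
        ((hF.comp measurable_unitVector).mul (hρ.comp measurable_norm)) hLm, hc,
      lintegral_smul_measure, lintegral_polar hF hρ, Measure.smul_apply,
      ← lintegral_indicator_one hs, lintegral_map hF hval]
    simp only [smul_eq_mul]
    ring
  have h1 := congrArg (fun μ => μ Set.univ) key
  have : IsProbabilityMeasure ((Measure.pi fun _ : Fin D => complexGaussian v).map
    (fun ξ => unitVector (L ξ))) := Measure.isProbabilityMeasure_map hmeas.aemeasurable
  simp only [measure_univ, Measure.smul_apply, Measure.map_apply hval MeasurableSet.univ,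
    Set.preimage_univ, smul_eq_mul] at h1
  rw [key, haarSphere, Measure.map_smul, ENNReal.eq_inv_of_mul_eq_one_left h1.symm]

/-! ### Gaussian integrals of homogeneous polynomials -/

/-- The polynomial `∑ j, w j * z_{j 1} ⋯ z_{j k}`, homogeneous of degree `k`, whose coefficients
are indexed by the product basis of `(ℂ^D)^{⊗ k}`. -/
noncomputable def tensorForm {D k : ℕ} (w : (Fin k → Fin D) → ℂ) (z : Hilb D) : ℂ :=
  ∑ j, w j * ∏ a, z (j a)

/-- The diagonal quadratic form `∑ i, lam i * |z i|²`. -/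
noncomputable def diagForm {D : ℕ} (lam : Fin D → ℝ) (z : Hilb D) : ℝ :=
  ∑ i, lam i * ‖z i‖ ^ 2

theorem continuous_coord {D : ℕ} (i : Fin D) : Continuous fun z : Hilb D => z i := by
  fun_prop

@[fun_prop]
theorem continuous_tensorForm {D k : ℕ} (w : (Fin k → Fin D) → ℂ) :
    Continuous (tensorForm w) := by
  unfold tensorForm; fun_prop

@[fun_prop]
theorem continuous_diagForm {D : ℕ} (lam : Fin D → ℝ) : Continuous (diagForm lam) := by
  unfold diagForm; fun_prop

@[fun_prop]
theorem measurable_tensorForm {D k : ℕ} (w : (Fin k → Fin D) → ℂ) :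
    Measurable (tensorForm w) := (continuous_tensorForm w).measurable

@[fun_prop]
theorem measurable_diagForm {D : ℕ} (lam : Fin D → ℝ) : Measurable (diagForm lam) :=
  (continuous_diagForm lam).measurable

theorem diagForm_nonneg {D : ℕ} {lam : Fin D → ℝ} (h : ∀ i, 0 ≤ lam i) (z : Hilb D) :
    0 ≤ diagForm lam z :=
  Finset.sum_nonneg fun i _ => mul_nonneg (h i) (sq_nonneg _)

theorem mul_norm_sq_le_diagForm {D : ℕ} {lam : Fin D → ℝ} {m : ℝ} (h : ∀ i, m ≤ lam i)
    (z : Hilb D) : m * ‖z‖ ^ 2 ≤ diagForm lam z := by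
  rw [EuclideanSpace.norm_sq_eq, Finset.mul_sum]
  exact Finset.sum_le_sum fun i _ => mul_le_mul_of_nonneg_right (h i) (sq_nonneg _)

theorem diagForm_le_mul_norm_sq {D : ℕ} {lam : Fin D → ℝ} {s : ℝ} (h : ∀ i, lam i ≤ s)
    (z : Hilb D) : diagForm lam z ≤ s * ‖z‖ ^ 2 := by
  rw [EuclideanSpace.norm_sq_eq, Finset.mul_sum]
  exact Finset.sum_le_sum fun i _ => mul_le_mul_of_nonneg_right (h i) (sq_nonneg _)

theorem norm_prod_coord_le {D k : ℕ} (z : Hilb D) (j : Fin k → Fin D) :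
    ‖∏ a, z (j a)‖ ≤ ‖z‖ ^ k := by
  rw [norm_prod]
  calc ∏ a, ‖z (j a)‖ ≤ ∏ _a : Fin k, ‖z‖ :=
        Finset.prod_le_prod (fun _ _ => norm_nonneg _) fun a _ => PiLp.norm_apply_le z (j a)
    _ = ‖z‖ ^ k := by simp

theorem norm_tensorForm_le {D k : ℕ} (w : (Fin k → Fin D) → ℂ) (z : Hilb D) :
    ‖tensorForm w z‖ ≤ (∑ j, ‖w j‖) * ‖z‖ ^ k := by
  rw [Finset.sum_mul]
  refine (norm_sum_le _ _).trans (Finset.sum_le_sum fun j _ => ?_)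
  rw [norm_mul]
  exact mul_le_mul_of_nonneg_left (norm_prod_coord_le z j) (norm_nonneg _)

theorem integrable_exp_neg_mul_norm_sq {D : ℕ} {b : ℝ} (hb : 0 < b) :
    Integrable fun z : Hilb D => Real.exp (-b * ‖z‖ ^ 2) := by
  have h := (GaussianFourier.integrable_cexp_neg_mul_sq_norm_add (V := Hilb D) (b := (b : ℂ))
    (by simpa using hb) 0 0).norm
  refine h.congr (Filter.Eventually.of_forall fun z => ?_)
  simp [Complex.norm_exp, ← Complex.ofReal_pow]

/-- Measurable functions dominated by a Gaussian are integrable. -/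
theorem integrable_of_le_gaussian {D : ℕ} {E : Type*} [NormedAddCommGroup E] {f : Hilb D → E}
    (hf : AEStronglyMeasurable f volume) {C b : ℝ} (hb : 0 < b)
    (h : ∀ z, ‖f z‖ ≤ C * Real.exp (-b * ‖z‖ ^ 2)) : Integrable f :=
  ((integrable_exp_neg_mul_norm_sq hb).const_mul C).mono' hf (Filter.Eventually.of_forall h)

theorem act_diagonal {D : ℕ} (d : Fin D → ℂ) (z : Hilb D) (i : Fin D) :
    act (Matrix.diagonal d) z i = d i * z i := by
  rw [act_apply, Finset.sum_eq_single i] <;> simp +contextual [eq_comm]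

theorem tensorForm_act_diagonal {D k : ℕ} (w : (Fin k → Fin D) → ℂ) (d : Fin D → ℂ) (z : Hilb D) :
    tensorForm w (act (Matrix.diagonal d) z) = tensorForm (fun j => (∏ a, d (j a)) * w j) z := by
  unfold tensorForm
  refine Finset.sum_congr rfl fun j _ => ?_
  simp_rw [act_diagonal, Finset.prod_mul_distrib]
  ring

theorem diagForm_act_diagonal {D : ℕ} (lam : Fin D → ℝ) (d : Fin D → ℂ) (z : Hilb D) :
    diagForm lam (act (Matrix.diagonal d) z) = diagForm (fun i => lam i * ‖d i‖ ^ 2) z := by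
  unfold diagForm
  refine Finset.sum_congr rfl fun j _ => ?_
  rw [act_diagonal, norm_mul, mul_pow, mul_assoc]

/-- Integrals of monomials `z^i conj(z^j)` against a phase invariant weight vanish unless `i` and
`j` have the same total weight for every assignment `f` of weights to the coordinates. -/
theorem integral_monomial_eq_zero {D k : ℕ} {W : Hilb D → ℝ}
    (hW : ∀ (d : Fin D → ℂ), (∀ i, ‖d i‖ = 1) → ∀ z, W (act (Matrix.diagonal d) z) = W z)
    (f : Fin D → ℝ) {i j : Fin k → Fin D} (hij : ∑ a, f (i a) ≠ ∑ a, f (j a)) :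
    ∫ z : Hilb D, (W z : ℂ) * ((∏ a, z (i a)) * star (∏ a, z (j a))) = 0 := by
  -- rotate the coordinate `l` by the phase `θ f l`, where `θ` turns the monomial into its negative
  set θ : ℝ := Real.pi / (∑ a, f (i a) - ∑ a, f (j a)) with hθ
  set d : Fin D → ℂ := fun l => Complex.exp ((θ * f l : ℝ) * Complex.I) with hd
  have hd1 : ∀ l, ‖d l‖ = 1 := fun l => Complex.norm_exp_ofReal_mul_I _
  have hdet : ‖(Matrix.diagonal d).det‖ = 1 := by
    rw [Matrix.det_diagonal, norm_prod]; simp [hd1]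
  have hdet0 : (Matrix.diagonal d).det ≠ 0 := by
    rw [← norm_ne_zero_iff, hdet]; exact one_ne_zero
  have hprod : ∀ l : Fin k → Fin D,
      ∏ a, d (l a) = Complex.exp ((θ * ∑ a, f (l a) : ℝ) * Complex.I) := fun l => by
    rw [hd, ← Complex.exp_sum, ← Finset.sum_mul, Finset.mul_sum]
    push_cast; rfl
  have hphase : (∏ a, d (i a)) * star (∏ a, d (j a)) = -1 := by
    rw [hprod, hprod, Complex.star_def, ← Complex.exp_conj, ← Complex.exp_add]
    rw [← Complex.exp_pi_mul_I]
    congr 1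
    have : Real.pi = θ * ∑ a, f (i a) - θ * ∑ a, f (j a) := by
      rw [hθ, ← mul_sub, div_mul_cancel₀ _ (sub_ne_zero.2 hij)]
    rw [this]
    simp only [map_mul, Complex.conj_ofReal, Complex.conj_I]
    push_cast; ring
  have h := integral_comp_act hdet0
    (fun z : Hilb D => (W z : ℂ) * ((∏ a, z (i a)) * star (∏ a, z (j a))))
  rw [hdet, one_pow, inv_one, one_smul] at h
  rw [← CharZero.eq_neg_self_iff, ← integral_neg]
  conv_lhs => rw [← h]
  refine integral_congr_ae (Filter.Eventually.of_forall fun z => ?_)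
  simp only [hW d hd1, act_diagonal, Finset.prod_mul_distrib, star_mul']
  linear_combination ((W z : ℂ) * ((∏ a, z (i a)) * star (∏ a, z (j a)))) * hphase

theorem norm_sq_tensorForm {D k : ℕ} (w : (Fin k → Fin D) → ℂ) (z : Hilb D) :
    ((‖tensorForm w z‖ ^ 2 : ℝ) : ℂ) =
      ∑ i, ∑ j, w i * star (w j) * ((∏ a, z (i a)) * star (∏ a, z (j a))) := by
  rw [Complex.ofReal_pow, ← Complex.mul_conj', tensorForm, map_sum, Finset.sum_mul_sum]
  refine Finset.sum_congr rfl fun i _ => Finset.sum_congr rfl fun j _ => ?_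
  simp only [map_mul, Complex.star_def]
  ring

theorem measurable_prod_coord {D k : ℕ} (j : Fin k → Fin D) :
    Measurable fun z : Hilb D => ∏ a, z (j a) :=
  Finset.measurable_prod _ fun a _ => (continuous_coord (j a)).measurable

/-- Expansion of a weighted integral of `|p|²` into the Gram matrix of the monomials. -/
theorem integral_weight_tensorForm {D k : ℕ} {W : Hilb D → ℝ} (hWm : Measurable W)
    (hW0 : ∀ z, 0 ≤ W z) {C b : ℝ} (hb : 0 < b)
    (hWb : ∀ z, W z * ‖z‖ ^ (2 * k) ≤ C * Real.exp (-b * ‖z‖ ^ 2)) (w : (Fin k → Fin D) → ℂ) :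
    ((∫ z, W z * ‖tensorForm w z‖ ^ 2 : ℝ) : ℂ) =
      ∑ i, ∑ j, w i * star (w j) *
        ∫ z : Hilb D, (W z : ℂ) * ((∏ a, z (i a)) * star (∏ a, z (j a))) := by
  rw [← integral_complex_ofReal]
  have hint : ∀ i j : Fin k → Fin D, Integrable fun z : Hilb D =>
      (W z : ℂ) * ((∏ a, z (i a)) * star (∏ a, z (j a))) := fun i j => by
    have hm := (measurable_prod_coord (D := D) i).mul
      (continuous_star.measurable.comp (measurable_prod_coord (D := D) j))
    refine integrable_of_le_gaussian (hWm.complex_ofReal.mul hm).aestronglyMeasurable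
      hb (C := C) fun z => ?_
    rw [norm_mul, norm_mul, norm_star, Complex.norm_real, Real.norm_of_nonneg (hW0 z)]
    refine le_trans ?_ (hWb z)
    rw [two_mul, pow_add]
    gcongr
    · exact hW0 z
    · exact norm_prod_coord_le z i
    · exact norm_prod_coord_le z j
  have hexp : ∀ z : Hilb D, ((W z * ‖tensorForm w z‖ ^ 2 : ℝ) : ℂ) =
      ∑ i, ∑ j, w i * star (w j) * ((W z : ℂ) * ((∏ a, z (i a)) * star (∏ a, z (j a)))) := by
    intro z
    rw [Complex.ofReal_mul, norm_sq_tensorForm, Finset.mul_sum]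
    refine Finset.sum_congr rfl fun i _ => ?_
    rw [Finset.mul_sum]
    exact Finset.sum_congr rfl fun j _ => by ring
  simp_rw [hexp]
  rw [integral_finsetSum _ fun i _ => integrable_finsetSum _ fun j _ => (hint i j).const_mul _]
  refine Finset.sum_congr rfl fun i _ => ?_
  rw [integral_finsetSum _ fun j _ => (hint i j).const_mul _]
  exact Finset.sum_congr rfl fun j _ => integral_const_mul _ _

/-- Rescaling the coordinates of a homogeneous polynomial by factors in `(0, m]` increases the
integral of its squared modulus against a phase invariant weight by at most `m ^ (2 * k)`. By phase
invariance the monomials with different scaling factors `c` are orthogonal, so the defect is the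
integral of the squared modulus of the polynomial with coefficients scaled by `√(m ^ (2 k) - c²)`. -/
theorem integral_weight_tensorForm_scale_le {D k : ℕ} {W : Hilb D → ℝ} (hWm : Measurable W)
    (hW0 : ∀ z, 0 ≤ W z) {C b : ℝ} (hb : 0 < b)
    (hWb : ∀ z, W z * ‖z‖ ^ (2 * k) ≤ C * Real.exp (-b * ‖z‖ ^ 2))
    (hW : ∀ (d : Fin D → ℂ), (∀ i, ‖d i‖ = 1) → ∀ z, W (act (Matrix.diagonal d) z) = W z)
    {d : Fin D → ℝ} {m : ℝ} (hd0 : ∀ i, 0 < d i) (hdm : ∀ i, d i ≤ m) (w : (Fin k → Fin D) → ℂ) :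
    ∫ z, W z * ‖tensorForm (fun j => ((∏ a, d (j a) : ℝ) : ℂ) * w j) z‖ ^ 2 ≤
      m ^ (2 * k) * ∫ z, W z * ‖tensorForm w z‖ ^ 2 := by
  set c : (Fin k → Fin D) → ℝ := fun j => ∏ a, d (j a) with hc
  have hc0 : ∀ j, 0 < c j := fun j => Finset.prod_pos fun a _ => hd0 _
  have hcm : ∀ j, c j ≤ m ^ k := fun j => by
    calc c j ≤ ∏ _a : Fin k, m := Finset.prod_le_prod (fun a _ => (hd0 _).le) fun a _ => hdm _
      _ = m ^ k := by simp
  set e : (Fin k → Fin D) → ℝ := fun j => √(m ^ (2 * k) - c j ^ 2) with he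
  have he2 : ∀ j, c j * c j + e j * e j = m ^ (2 * k) := fun j => by
    have : c j ^ 2 ≤ m ^ (2 * k) := by
      rw [mul_comm, pow_mul]; exact pow_le_pow_left₀ (hc0 j).le (hcm j) 2
    rw [he]
    simp only
    rw [Real.mul_self_sqrt (sub_nonneg.2 this)]; ring
  set M : (Fin k → Fin D) → (Fin k → Fin D) → ℂ := fun i j =>
    ∫ z : Hilb D, (W z : ℂ) * ((∏ a, z (i a)) * star (∏ a, z (j a))) with hM
  -- the coordinate weights are the logarithms of the scaling factors
  have hMc : ∀ i j, c i ≠ c j → M i j = 0 := fun i j hij => by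
    refine integral_monomial_eq_zero hW (fun l => Real.log (d l)) fun h => hij ?_
    have hlog : ∀ l, Real.log (c l) = ∑ a, Real.log (d (l a)) := fun l =>
      Real.log_prod fun a _ => (hd0 _).ne'
    exact Real.log_injOn_pos (hc0 i) (hc0 j) (by rw [hlog, hlog, h])
  have key : (∫ z, W z * ‖tensorForm (fun j => (c j : ℂ) * w j) z‖ ^ 2) +
      ∫ z, W z * ‖tensorForm (fun j => (e j : ℂ) * w j) z‖ ^ 2 =
      m ^ (2 * k) * ∫ z, W z * ‖tensorForm w z‖ ^ 2 := by
    rw [← Complex.ofReal_inj, Complex.ofReal_add, Complex.ofReal_mul,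
      integral_weight_tensorForm hWm hW0 hb hWb, integral_weight_tensorForm hWm hW0 hb hWb,
      integral_weight_tensorForm hWm hW0 hb hWb, ← Finset.sum_add_distrib, Finset.mul_sum]
    refine Finset.sum_congr rfl fun i _ => ?_
    rw [← Finset.sum_add_distrib, Finset.mul_sum]
    refine Finset.sum_congr rfl fun j _ => ?_
    change _ * M i j + _ * M i j = _ * (_ * M i j)
    by_cases hij : c i = c j
    · have hee : e i = e j := by simp only [he, hij]
      rw [← he2 i]
      simp only [star_mul', Complex.star_def, Complex.conj_ofReal, ← hij, ← hee]
      push_cast; ring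
    · rw [hMc i j hij]; simp
  rw [← key]
  exact le_add_of_nonneg_right (integral_nonneg fun z => mul_nonneg (hW0 z) (sq_nonneg _))

/-! ### First-order comparison of homogeneous Gaussian integrals -/

/-- The function `|p|² / X ^ k`, homogeneous of degree `0`, where `p` is the form of degree `k` with
coefficients `w` and `X` is the diagonal quadratic form with entries `lam`. Its value at the origin
is `0` for `k ≠ 0`. -/
noncomputable def ratio {D k : ℕ} (lam : Fin D → ℝ) (w : (Fin k → Fin D) → ℂ) (z : Hilb D) : ℝ :=
  (diagForm lam z)⁻¹ ^ k * ‖tensorForm w z‖ ^ 2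

theorem exists_pos_forall_le {D : ℕ} {lam : Fin D → ℝ} (h : ∀ i, 0 < lam i) :
    ∃ m : ℝ, 0 < m ∧ ∀ i, m ≤ lam i := by
  rcases isEmpty_or_nonempty (Fin D) with hD | hD
  · exact ⟨1, one_pos, fun i => hD.elim i⟩
  · obtain ⟨i, hi⟩ := Finite.exists_min lam
    exact ⟨lam i, h i, hi⟩

theorem inv_diagForm_mul_norm_sq_le {D : ℕ} {lam : Fin D → ℝ} {m : ℝ} (hm : 0 < m)
    (h : ∀ i, m ≤ lam i) (z : Hilb D) : (diagForm lam z)⁻¹ * ‖z‖ ^ 2 ≤ m⁻¹ := by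
  rcases (diagForm_nonneg (fun i => hm.le.trans (h i)) z).eq_or_lt with h0 | h0
  · rw [← h0]; simpa using hm.le
  · rw [inv_mul_le_iff₀ h0, ← div_eq_mul_inv, le_div_iff₀ hm, mul_comm]
    exact mul_norm_sq_le_diagForm h z

@[fun_prop]
theorem measurable_ratio {D k : ℕ} (lam : Fin D → ℝ) (w : (Fin k → Fin D) → ℂ) :
    Measurable (ratio lam w) := by
  unfold ratio; fun_prop

theorem ratio_nonneg {D k : ℕ} {lam : Fin D → ℝ} (h : ∀ i, 0 < lam i) (w : (Fin k → Fin D) → ℂ)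
    (z : Hilb D) : 0 ≤ ratio lam w z :=
  mul_nonneg (pow_nonneg (inv_nonneg.2 (diagForm_nonneg (fun i => (h i).le) z)) _) (sq_nonneg _)

theorem exists_ratio_le {D k : ℕ} {lam : Fin D → ℝ} (h : ∀ i, 0 < lam i)
    (w : (Fin k → Fin D) → ℂ) : ∃ B, 0 ≤ B ∧ ∀ z, ratio lam w z ≤ B := by
  obtain ⟨m, hm, hml⟩ := exists_pos_forall_le h
  refine ⟨m⁻¹ ^ k * (∑ j, ‖w j‖) ^ 2, by positivity, fun z => ?_⟩
  have hX := inv_nonneg.2 (diagForm_nonneg (fun i => (h i).le) z)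
  calc ratio lam w z ≤ (diagForm lam z)⁻¹ ^ k * ((∑ j, ‖w j‖) * ‖z‖ ^ k) ^ 2 := by
        unfold ratio
        gcongr
        exact norm_tensorForm_le w z
    _ = ((diagForm lam z)⁻¹ * ‖z‖ ^ 2) ^ k * (∑ j, ‖w j‖) ^ 2 := by ring
    _ ≤ _ := by
        gcongr
        exact inv_diagForm_mul_norm_sq_le hm hml z

theorem integrable_ratio_mul {D k : ℕ} {lam : Fin D → ℝ} (h : ∀ i, 0 < lam i)
    (w : (Fin k → Fin D) → ℂ) {g : Hilb D → ℝ} (hg : Measurable g) {C b : ℝ} (hb : 0 < b)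
    (hgb : ∀ z, |g z| ≤ C * Real.exp (-b * ‖z‖ ^ 2)) : Integrable fun z => ratio lam w z * g z := by
  obtain ⟨B, hB, hr⟩ := exists_ratio_le h w
  refine integrable_of_le_gaussian (Measurable.aestronglyMeasurable (by fun_prop)) hb (C := B * C)
    fun z => ?_
  rw [norm_mul, Real.norm_of_nonneg (ratio_nonneg h w z), Real.norm_eq_abs, mul_assoc]
  exact mul_le_mul (hr z) (hgb z) (abs_nonneg _) hB

theorem integrable_ratio_mul_gaussian {D k : ℕ} {lam : Fin D → ℝ} (h : ∀ i, 0 < lam i)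
    (w : (Fin k → Fin D) → ℂ) : Integrable fun z => ratio lam w z * Real.exp (-‖z‖ ^ 2) :=
  integrable_ratio_mul h w (by fun_prop) one_pos (C := 1) fun z => by simp

theorem integrable_ratio_mul_diagForm_mul_gaussian {D k : ℕ} {lam : Fin D → ℝ} {s : ℝ}
    (h : ∀ i, 0 < lam i) (hs0 : 0 ≤ s) (hs : ∀ i, lam i ≤ s) (w : (Fin k → Fin D) → ℂ) :
    Integrable fun z => ratio lam w z * (diagForm lam z * Real.exp (-‖z‖ ^ 2)) := by
  refine integrable_ratio_mul h w (by fun_prop) one_half_pos (C := 2 * s) fun z => ?_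
  rw [abs_of_nonneg (mul_nonneg (diagForm_nonneg (fun i => (h i).le) z) (Real.exp_pos _).le)]
  have h1 : ‖z‖ ^ 2 / 2 ≤ Real.exp (‖z‖ ^ 2 / 2) := by
    linarith [Real.add_one_le_exp (‖z‖ ^ 2 / 2)]
  calc diagForm lam z * Real.exp (-‖z‖ ^ 2)
      ≤ (s * ‖z‖ ^ 2) * Real.exp (-‖z‖ ^ 2) := by
        gcongr; exact diagForm_le_mul_norm_sq hs z
    _ = 2 * s * ((‖z‖ ^ 2 / 2) * Real.exp (-‖z‖ ^ 2)) := by ring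
    _ ≤ 2 * s * (Real.exp (‖z‖ ^ 2 / 2) * Real.exp (-‖z‖ ^ 2)) := by gcongr
    _ = _ := by rw [← Real.exp_add]; congr 2; ring

theorem integrable_ratio_mul_exp {D k : ℕ} {lam : Fin D → ℝ} {t b : ℝ}
    (h : ∀ i, 0 < lam i) (hb : 0 < b) (ht : ∀ i, b ≤ 1 + t * lam i) (w : (Fin k → Fin D) → ℂ) :
    Integrable fun z => ratio lam w z * (Real.exp (-(t * diagForm lam z)) * Real.exp (-‖z‖ ^ 2)) := by
  refine integrable_ratio_mul h w (by fun_prop) hb (C := 1) fun z => ?_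
  rw [abs_of_nonneg (by positivity), ← Real.exp_add, one_mul]
  refine Real.exp_le_exp.2 ?_
  have := mul_norm_sq_le_diagForm ht z
  have e : diagForm (fun i => 1 + t * lam i) z = ‖z‖ ^ 2 + t * diagForm lam z := by
    simp only [diagForm, EuclideanSpace.norm_sq_eq, Finset.mul_sum, ← Finset.sum_add_distrib]
    exact Finset.sum_congr rfl fun i _ => by ring
  linarith

/-- Distortion of a homogeneous Gaussian integral under a diagonal change of scale: the numerator
contributes the factor `m₂ ^ (2 k)`, the denominator `m₁ ^ (-2 k)`. -/
theorem integral_ratio_scale_le {D k : ℕ} {lam : Fin D → ℝ} (h : ∀ i, 0 < lam i)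
    {d : Fin D → ℝ} {m₁ m₂ : ℝ} (hm₁ : 0 < m₁) (hd₁ : ∀ i, m₁ ≤ d i) (hd₂ : ∀ i, d i ≤ m₂)
    (hm₂ : 0 ≤ m₂) (w : (Fin k → Fin D) → ℂ) :
    ∫ z, ratio lam w (act (Matrix.diagonal fun i => (d i : ℂ)) z) * Real.exp (-‖z‖ ^ 2) ≤
      (m₂ / m₁) ^ (2 * k) * ∫ z, ratio lam w z * Real.exp (-‖z‖ ^ 2) := by
  have hd0 : ∀ i, 0 < d i := fun i => hm₁.trans_le (hd₁ i)
  set mu : Fin D → ℝ := fun i => lam i * d i ^ 2 with hmu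
  have hmu0 : ∀ i, 0 < mu i := fun i => mul_pos (h i) (pow_pos (hd0 i) 2)
  set W : Hilb D → ℝ := fun z => (diagForm mu z)⁻¹ ^ k * Real.exp (-‖z‖ ^ 2) with hWdef
  have hWm : Measurable W := by fun_prop
  have hX0 : ∀ z, 0 ≤ (diagForm mu z)⁻¹ := fun z =>
    inv_nonneg.2 (diagForm_nonneg (fun i => (hmu0 i).le) z)
  have hW0 : ∀ z, 0 ≤ W z := fun z => mul_nonneg (pow_nonneg (hX0 z) _) (Real.exp_pos _).le
  obtain ⟨m, hm, hml⟩ := exists_pos_forall_le hmu0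
  have hWb : ∀ z, W z * ‖z‖ ^ (2 * k) ≤ m⁻¹ ^ k * Real.exp (-1 * ‖z‖ ^ 2) := fun z => by
    have e : W z * ‖z‖ ^ (2 * k) =
        ((diagForm mu z)⁻¹ * ‖z‖ ^ 2) ^ k * Real.exp (-1 * ‖z‖ ^ 2) := by
      simp only [hWdef, neg_one_mul]; ring
    rw [e]
    have := hX0 z
    gcongr
    exact inv_diagForm_mul_norm_sq_le hm hml z
  have hWphase : ∀ (d : Fin D → ℂ), (∀ i, ‖d i‖ = 1) →
      ∀ z, W (act (Matrix.diagonal d) z) = W z := fun d hd z => by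
    have : ‖act (Matrix.diagonal d) z‖ ^ 2 = ‖z‖ ^ 2 := by
      simp [EuclideanSpace.norm_sq_eq, act_diagonal, hd]
    simp only [hWdef, this, diagForm_act_diagonal, hd, one_pow, mul_one]
  have h1 := integral_weight_tensorForm_scale_le hWm hW0 one_pos hWb hWphase hd0 hd₂ w
  have e1 : ∀ z, ratio lam w (act (Matrix.diagonal fun i => (d i : ℂ)) z) * Real.exp (-‖z‖ ^ 2) =
      W z * ‖tensorForm (fun j => ((∏ a, d (j a) : ℝ) : ℂ) * w j) z‖ ^ 2 := fun z => by
    simp only [ratio, diagForm_act_diagonal, tensorForm_act_diagonal, hWdef, hmu,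
      Complex.norm_real, Real.norm_eq_abs, sq_abs, Complex.ofReal_prod]
    ring
  simp_rw [e1]
  refine h1.trans ?_
  rw [div_pow, div_eq_mul_inv, mul_assoc]
  refine mul_le_mul_of_nonneg_left ?_ (pow_nonneg hm₂ _)
  rw [← integral_const_mul]
  refine integral_mono_of_nonneg (Filter.Eventually.of_forall fun z =>
    mul_nonneg (hW0 z) (sq_nonneg _)) ((integrable_ratio_mul_gaussian h w).const_mul _)
    (Filter.Eventually.of_forall fun z => ?_)
  have hX : (diagForm mu z)⁻¹ ≤ (m₁ ^ 2)⁻¹ * (diagForm lam z)⁻¹ := by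
    have hle : m₁ ^ 2 * diagForm lam z ≤ diagForm mu z := by
      simp only [diagForm, Finset.mul_sum, hmu]
      refine Finset.sum_le_sum fun i _ => ?_
      have : m₁ ^ 2 ≤ d i ^ 2 := pow_le_pow_left₀ hm₁.le (hd₁ i) 2
      have h2 := mul_le_mul_of_nonneg_right this
        (mul_nonneg (h i).le (sq_nonneg ‖z i‖))
      linarith
    -- where `X` vanishes, both inverses are the junk value `0`
    rcases (diagForm_nonneg (fun i => (h i).le) z).eq_or_lt with h0 | h0
    · have hz : z = 0 := by
        obtain ⟨m', hm', hml'⟩ := exists_pos_forall_le h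
        have := mul_norm_sq_le_diagForm hml' z
        rw [← h0] at this
        have hn : ‖z‖ ^ 2 ≤ 0 := nonpos_of_mul_nonpos_right this hm'
        simpa using le_antisymm hn (sq_nonneg _)
      subst hz
      simp [diagForm]
    · rw [← mul_inv]
      exact inv_anti₀ (mul_pos (pow_pos hm₁ 2) h0) hle
  have e2 : (m₁ ^ (2 * k))⁻¹ * (ratio lam w z * Real.exp (-‖z‖ ^ 2)) =
      ((m₁ ^ 2)⁻¹ * (diagForm lam z)⁻¹) ^ k * Real.exp (-‖z‖ ^ 2) * ‖tensorForm w z‖ ^ 2 := by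
    simp only [ratio, pow_mul, mul_pow, inv_pow]; ring
  simp only [e2, hWdef]
  have := hX0 z
  gcongr

/-- The tilt `exp (-t X)` of the Gaussian weight is absorbed by a linear change of variables. -/
theorem integral_ratio_mul_exp {D k : ℕ} {lam : Fin D → ℝ} {t : ℝ} (ht : ∀ i, 0 < 1 + t * lam i)
    (w : (Fin k → Fin D) → ℂ) :
    ∫ z, ratio lam w z * (Real.exp (-(t * diagForm lam z)) * Real.exp (-‖z‖ ^ 2)) =
      (∏ i, (1 + t * lam i))⁻¹ *
        ∫ z, ratio lam w (act (Matrix.diagonal fun i => (((√(1 + t * lam i))⁻¹ : ℝ) : ℂ)) z) *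
          Real.exp (-‖z‖ ^ 2) := by
  set d : Fin D → ℂ := fun i => (((√(1 + t * lam i))⁻¹ : ℝ) : ℂ) with hd
  have hd2 : ∀ i, ‖d i‖ ^ 2 = (1 + t * lam i)⁻¹ := fun i => by
    rw [hd, Complex.norm_real, Real.norm_eq_abs, sq_abs, inv_pow, Real.sq_sqrt (ht i).le]
  have hdet : ‖(Matrix.diagonal d).det‖ ^ 2 = (∏ i, (1 + t * lam i))⁻¹ := by
    rw [Matrix.det_diagonal, norm_prod, ← Finset.prod_pow, ← Finset.prod_inv_distrib]
    exact Finset.prod_congr rfl fun i _ => hd2 i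
  have hpos : 0 < ∏ i, (1 + t * lam i) := Finset.prod_pos fun i _ => ht i
  have hdet0 : (Matrix.diagonal d).det ≠ 0 := fun h0 => by
    rw [h0] at hdet
    simp at hdet
    exact hpos.ne hdet
  have hcv := integral_comp_act hdet0 fun z : Hilb D =>
    ratio lam w z * (Real.exp (-(t * diagForm lam z)) * Real.exp (-‖z‖ ^ 2))
  rw [hdet, inv_inv, smul_eq_mul] at hcv
  rw [eq_inv_mul_iff_mul_eq₀ hpos.ne', ← hcv]
  refine integral_congr_ae (Filter.Eventually.of_forall fun z => ?_)
  simp only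
  rw [← Real.exp_add]
  congr 2
  rw [EuclideanSpace.norm_sq_eq, EuclideanSpace.norm_sq_eq, diagForm, Finset.mul_sum,
    ← Finset.sum_neg_distrib, ← Finset.sum_neg_distrib, ← Finset.sum_neg_distrib,
    ← Finset.sum_add_distrib]
  refine Finset.sum_congr rfl fun i _ => ?_
  rw [act_diagonal, norm_mul, mul_pow, hd2]
  have := (ht i).ne'
  field_simp
  ring

/-- A linear minorant to the right of `0` that touches at `0` has slope at most the derivative. -/
theorem le_of_hasDerivAt_of_forall_add_mul_le {φ : ℝ → ℝ} {φ' b t₀ : ℝ} (hφ : HasDerivAt φ φ' 0)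
    (ht₀ : 0 < t₀) (h : ∀ t, 0 < t → t < t₀ → φ 0 + t * b ≤ φ t) : b ≤ φ' := by
  refine ge_of_tendsto hφ.tendsto_slope_zero_right ?_
  filter_upwards [Ioo_mem_nhdsGT ht₀] with t ht
  rw [zero_add, smul_eq_mul, le_inv_mul_iff₀ ht.1]
  linarith [h t ht.1 ht.2]

theorem hasDerivAt_prod_one_add_mul {D : ℕ} (lam : Fin D → ℝ) :
    HasDerivAt (fun t : ℝ => ∏ i, (1 + t * lam i)) (∑ i, lam i) 0 := by
  have h := HasDerivAt.fun_finsetProd (u := Finset.univ) (x := (0 : ℝ))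
    (f := fun (i : Fin D) (t : ℝ) => 1 + t * lam i) (f' := lam)
    fun i _ => by simpa using ((hasDerivAt_id (0 : ℝ)).mul_const (lam i)).const_add 1
  simpa using h

/-- Lower bound for the mean of `X` under the weight `|p|² / X ^ k`, by differentiating the
inequality `∫ h (1 - t X) γ ≤ ∫ h exp (-t X) γ` at `t = 0` from the right. -/
theorem sub_mul_integral_ratio_le {D k : ℕ} {lam : Fin D → ℝ} {s : ℝ} (h : ∀ i, 0 < lam i)
    (hs0 : 0 ≤ s) (hs : ∀ i, lam i ≤ s) (w : (Fin k → Fin D) → ℂ) :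
    (∑ i, lam i - k * s) * ∫ z, ratio lam w z * Real.exp (-‖z‖ ^ 2) ≤
      ∫ z, ratio lam w z * (diagForm lam z * Real.exp (-‖z‖ ^ 2)) := by
  set J₀ := ∫ z, ratio lam w z * Real.exp (-‖z‖ ^ 2) with hJ₀
  set J₁ := ∫ z, ratio lam w z * (diagForm lam z * Real.exp (-‖z‖ ^ 2)) with hJ₁
  have hJ₀0 : 0 ≤ J₀ := integral_nonneg fun z => mul_nonneg (ratio_nonneg h w z) (Real.exp_pos _).le
  have hder : HasDerivAt (fun t : ℝ => (∏ i, (1 + t * lam i))⁻¹ * ((1 + t * s) ^ k * J₀))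
      ((k * s - ∑ i, lam i) * J₀) 0 := by
    have h1 := (hasDerivAt_prod_one_add_mul lam).fun_inv (by simp)
    have h2 := ((((hasDerivAt_id (0 : ℝ)).mul_const s).const_add 1).fun_pow k).mul_const J₀
    exact (h1.fun_mul h2).congr_deriv (by simp; ring)
  have key := le_of_hasDerivAt_of_forall_add_mul_le hder one_pos (b := -J₁) fun t ht _ => by
    have hti : ∀ i, 1 ≤ 1 + t * lam i := fun i => by
      linarith [mul_pos ht (h i)]
    have hts : 0 < 1 + t * s := by linarith [mul_nonneg ht.le hs0]
    calc _ = J₀ + t * -J₁ := by simp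
      _ = ∫ z, (ratio lam w z * Real.exp (-‖z‖ ^ 2) -
            t * (ratio lam w z * (diagForm lam z * Real.exp (-‖z‖ ^ 2)))) := by
          rw [integral_sub (integrable_ratio_mul_gaussian h w)
            ((integrable_ratio_mul_diagForm_mul_gaussian h hs0 hs w).const_mul t),
            integral_const_mul]
          ring
      _ ≤ ∫ z, ratio lam w z * (Real.exp (-(t * diagForm lam z)) * Real.exp (-‖z‖ ^ 2)) := by
          refine integral_mono ((integrable_ratio_mul_gaussian h w).sub
            ((integrable_ratio_mul_diagForm_mul_gaussian h hs0 hs w).const_mul t))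
            (integrable_ratio_mul_exp h one_pos hti w) fun z => ?_
          have h1 : 1 - t * diagForm lam z ≤ Real.exp (-(t * diagForm lam z)) := by
            linarith [Real.add_one_le_exp (-(t * diagForm lam z))]
          have h2 := mul_le_mul_of_nonneg_left h1
            (mul_nonneg (ratio_nonneg h w z) (Real.exp_pos (-‖z‖ ^ 2)).le)
          simp only
          linarith
      _ ≤ (∏ i, (1 + t * lam i))⁻¹ * ((1 + t * s) ^ k * J₀) := by
          rw [integral_ratio_mul_exp (fun i => one_pos.trans_le (hti i))]
          refine mul_le_mul_of_nonneg_left ?_ (inv_nonneg.2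
            (Finset.prod_nonneg fun i _ => zero_le_one.trans (hti i)))
          -- the scaling factors lie between `1 / √(1 + t s)` and `1`
          refine (integral_ratio_scale_le h (m₁ := (√(1 + t * s))⁻¹) (m₂ := 1)
            (inv_pos.2 (Real.sqrt_pos.2 hts)) (fun i => ?_) (fun i => ?_) zero_le_one w).trans_eq ?_
          · refine inv_anti₀ (Real.sqrt_pos.2 (one_pos.trans_le (hti i))) (Real.sqrt_le_sqrt ?_)
            gcongr
            exact hs i
          · exact inv_le_one_of_one_le₀ (Real.one_le_sqrt.2 (hti i))
          · rw [one_div, inv_inv, pow_mul, Real.sq_sqrt hts.le]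
  linarith

/-- Upper bound for the mean of `X` under the weight `|p|² / X ^ k`, by differentiating the
inequality `∫ h (1 + t X) γ ≤ ∫ h exp (t X) γ` at `t = 0` from the right. -/
theorem integral_ratio_le_add_mul {D k : ℕ} {lam : Fin D → ℝ} {s : ℝ} (h : ∀ i, 0 < lam i)
    (hs0 : 0 ≤ s) (hs : ∀ i, lam i ≤ s) (w : (Fin k → Fin D) → ℂ) :
    ∫ z, ratio lam w z * (diagForm lam z * Real.exp (-‖z‖ ^ 2)) ≤
      (∑ i, lam i + k * s) * ∫ z, ratio lam w z * Real.exp (-‖z‖ ^ 2) := by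
  set J₀ := ∫ z, ratio lam w z * Real.exp (-‖z‖ ^ 2) with hJ₀
  set J₁ := ∫ z, ratio lam w z * (diagForm lam z * Real.exp (-‖z‖ ^ 2)) with hJ₁
  have hder : HasDerivAt
      (fun t : ℝ => (∏ i, (1 + t * -lam i))⁻¹ * ((1 - t * s)⁻¹ ^ k * J₀))
      ((k * s + ∑ i, lam i) * J₀) 0 := by
    have h1 := (hasDerivAt_prod_one_add_mul fun i => -lam i).fun_inv (by simp)
    have h2 := (((((hasDerivAt_id (0 : ℝ)).mul_const s).const_sub 1).fun_inv
      (by simp)).fun_pow k).mul_const J₀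
    exact (h1.fun_mul h2).congr_deriv (by simp; ring)
  -- `t < 1 / (s + 1)` keeps `1 - t s` positive, so that the tilted weight is integrable
  have key := le_of_hasDerivAt_of_forall_add_mul_le hder (b := J₁) (t₀ := (s + 1)⁻¹)
      (by positivity) fun t ht ht1 => by
    have hts : 0 < 1 - t * s := by
      rw [lt_inv_comm₀ ht (by positivity), lt_inv_comm₀ (by positivity) ht] at ht1
      have : t * (s + 1) < 1 := by
        rwa [← lt_div_iff₀ (by positivity), one_div]
      linarith
    have hti : ∀ i, 1 - t * s ≤ 1 + -t * lam i := fun i => by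
      have := mul_le_mul_of_nonneg_left (hs i) ht.le
      linarith
    have hti0 : ∀ i, 0 < 1 + -t * lam i := fun i => hts.trans_le (hti i)
    calc _ = J₀ + t * J₁ := by simp
      _ = ∫ z, (ratio lam w z * Real.exp (-‖z‖ ^ 2) +
            t * (ratio lam w z * (diagForm lam z * Real.exp (-‖z‖ ^ 2)))) := by
          rw [integral_add (integrable_ratio_mul_gaussian h w)
            ((integrable_ratio_mul_diagForm_mul_gaussian h hs0 hs w).const_mul t),
            integral_const_mul]
      _ ≤ ∫ z, ratio lam w z * (Real.exp (-(-t * diagForm lam z)) * Real.exp (-‖z‖ ^ 2)) := by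
          refine integral_mono ((integrable_ratio_mul_gaussian h w).add
            ((integrable_ratio_mul_diagForm_mul_gaussian h hs0 hs w).const_mul t))
            (integrable_ratio_mul_exp h hts hti w) fun z => ?_
          have h1 : 1 + t * diagForm lam z ≤ Real.exp (-(-t * diagForm lam z)) := by
            linarith [Real.add_one_le_exp (-(-t * diagForm lam z))]
          have h2 := mul_le_mul_of_nonneg_left h1
            (mul_nonneg (ratio_nonneg h w z) (Real.exp_pos (-‖z‖ ^ 2)).le)
          simp only
          linarith
      _ ≤ (∏ i, (1 + -t * lam i))⁻¹ * ((1 - t * s)⁻¹ ^ k * J₀) := by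
          rw [integral_ratio_mul_exp hti0]
          refine mul_le_mul_of_nonneg_left ?_ (inv_nonneg.2
            (Finset.prod_nonneg fun i _ => (hti0 i).le))
          -- the scaling factors lie between `1` and `1 / √(1 - t s)`
          refine (integral_ratio_scale_le h (m₁ := 1) (m₂ := (√(1 - t * s))⁻¹)
            one_pos (fun i => ?_) (fun i => ?_) (by positivity) w).trans_eq ?_
          · refine (one_le_inv₀ (Real.sqrt_pos.2 (hti0 i))).2 (Real.sqrt_le_one.2 ?_)
            linarith [mul_pos ht (h i)]
          · exact inv_anti₀ (Real.sqrt_pos.2 hts) (Real.sqrt_le_sqrt (hti i))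
          · rw [div_one, pow_mul, inv_pow, Real.sq_sqrt hts.le]
      _ = _ := by simp only [neg_mul, mul_neg]
  linarith

/-! ### Spectral form of the Gibbs state -/

/-- The Hermitian matrix with eigenvalues `x`, diagonalized by `U`. -/
noncomputable def conjDiag {D : ℕ} (U : Matrix (Fin D) (Fin D) ℂ) (x : Fin D → ℝ) :
    Matrix (Fin D) (Fin D) ℂ :=
  U * Matrix.diagonal (fun i => (x i : ℂ)) * U.conjTranspose

theorem trace_conjDiag {D : ℕ} {U : Matrix (Fin D) (Fin D) ℂ} (hU : U.conjTranspose * U = 1)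
    (x : Fin D → ℝ) : (conjDiag U x).trace = ((∑ i, x i : ℝ) : ℂ) := by
  rw [conjDiag, Matrix.trace_mul_comm, ← mul_assoc, hU, one_mul, Matrix.trace_diagonal,
    Complex.ofReal_sum]

theorem smul_conjDiag {D : ℕ} (U : Matrix (Fin D) (Fin D) ℂ) (r : ℝ) (x : Fin D → ℝ) :
    r • conjDiag U x = conjDiag U (fun i => r * x i) := by
  have : Matrix.diagonal (fun i => ((r * x i : ℝ) : ℂ)) =
      r • Matrix.diagonal (fun i => (x i : ℂ)) := by
    ext i j
    by_cases h : i = j <;> simp [h]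
  rw [conjDiag, conjDiag, this, Matrix.mul_smul, Matrix.smul_mul]

theorem schattenTwo_conjDiag {D : ℕ} {U : Matrix (Fin D) (Fin D) ℂ}
    (hU : U.conjTranspose * U = 1) (x : Fin D → ℝ) :
    schattenTwo (conjDiag U x) = √(∑ i, x i ^ 2) := by
  have h : (conjDiag U x).conjTranspose * conjDiag U x = conjDiag U (fun i => x i ^ 2) := by
    have hd : (Matrix.diagonal fun i => (x i : ℂ)).conjTranspose =
        Matrix.diagonal fun i => (x i : ℂ) := by
      rw [Matrix.diagonal_conjTranspose]; congr 1; ext i; simp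
    rw [conjDiag, Matrix.conjTranspose_mul, Matrix.conjTranspose_mul, hd,
      Matrix.conjTranspose_conjTranspose]
    calc U * (Matrix.diagonal (fun i => (x i : ℂ)) * U.conjTranspose) *
          (U * Matrix.diagonal (fun i => (x i : ℂ)) * U.conjTranspose)
        = U * Matrix.diagonal (fun i => (x i : ℂ)) * (U.conjTranspose * U) *
          Matrix.diagonal (fun i => (x i : ℂ)) * U.conjTranspose := by simp only [mul_assoc]
      _ = U * (Matrix.diagonal (fun i => (x i : ℂ)) * Matrix.diagonal (fun i => (x i : ℂ))) *
          U.conjTranspose := by rw [hU, mul_one]; simp only [mul_assoc]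
      _ = _ := by
          rw [Matrix.diagonal_mul_diagonal, conjDiag]
          simp only [sq, Complex.ofReal_mul]
  rw [schattenTwo, h, trace_conjDiag hU, Complex.ofReal_re]

theorem cfc_eq_conjDiag {D : ℕ} {H : Matrix (Fin D) (Fin D) ℂ} (hH : H.IsHermitian) (f : ℝ → ℝ) :
    cfc f H = conjDiag (hH.eigenvectorUnitary : Matrix (Fin D) (Fin D) ℂ)
      (fun i => f (hH.eigenvalues i)) := by
  rw [hH.cfc_eq, Matrix.IsHermitian.cfc, Unitary.conjStarAlgAut_apply]
  rfl

theorem exp_smul_eq_cfc {D : ℕ} {H : Matrix (Fin D) (Fin D) ℂ} (hH : H.IsHermitian) (r : ℝ) :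
    NormedSpace.exp (r • H) = cfc (fun x => Real.exp (r * x)) H := by
  set U : Matrix (Fin D) (Fin D) ℂ := (hH.eigenvectorUnitary : Matrix (Fin D) (Fin D) ℂ) with hUdef
  have hU : U.conjTranspose * U = 1 := Unitary.coe_star_mul_self hH.eigenvectorUnitary
  have hinv : U⁻¹ = U.conjTranspose := Matrix.inv_eq_left_inv hU
  have hunit : IsUnit U := (Unitary.toUnits hH.eigenvectorUnitary).isUnit
  have h1 : r • H = U * Matrix.diagonal (fun i => ((r * hH.eigenvalues i : ℝ) : ℂ)) * U⁻¹ := by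
    have h := cfc_eq_conjDiag hH id
    rw [cfc_id ℝ H (show IsSelfAdjoint H from hH)] at h
    conv_lhs => rw [h]
    rw [smul_conjDiag, hinv]; rfl
  rw [h1, Matrix.exp_conj U _ hunit, Matrix.exp_diagonal, hinv, cfc_eq_conjDiag hH]
  rw [conjDiag]
  congr 3
  ext i
  rw [Pi.coe_exp, Complex.ofReal_exp, Complex.exp_eq_exp_ℂ]

/-- The Gibbs state and its square root are diagonal in a common orthonormal basis, with positive
eigenvalues `lam`, and `exp (-β H / 2)` is a positive multiple of the square root. -/
theorem exists_gibbs_spectral {D : ℕ} [NeZero D] {H : Matrix (Fin D) (Fin D) ℂ}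
    (hH : H.IsHermitian) (β : ℝ) :
    ∃ (U : Matrix (Fin D) (Fin D) ℂ) (lam : Fin D → ℝ) (c : ℝ), U.conjTranspose * U = 1 ∧
      (∀ i, 0 < lam i) ∧ ∑ i, lam i = 1 ∧ gibbs H β = conjDiag U lam ∧
      cfc Real.sqrt (gibbs H β) = conjDiag U (fun i => √(lam i)) ∧ 0 < c ∧
      NormedSpace.exp ((-β / 2) • H) = c • cfc Real.sqrt (gibbs H β) := by
  set U : Matrix (Fin D) (Fin D) ℂ := (hH.eigenvectorUnitary : Matrix (Fin D) (Fin D) ℂ) with hUdef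
  have hU : U.conjTranspose * U = 1 := Unitary.coe_star_mul_self hH.eigenvectorUnitary
  set Z : ℝ := ∑ i, Real.exp (-β * hH.eigenvalues i) with hZ
  have hZ0 : 0 < Z := Finset.sum_pos (fun i _ => Real.exp_pos _) Finset.univ_nonempty
  have hg : gibbs H β = cfc (fun x => Z⁻¹ * Real.exp (-β * x)) H := by
    rw [gibbs, exp_smul_eq_cfc hH, cfc_eq_conjDiag hH, cfc_eq_conjDiag hH, trace_conjDiag hU,
      ← hZ, ← Complex.ofReal_inv, Complex.coe_smul, smul_conjDiag]
  have hs : cfc Real.sqrt (gibbs H β) = cfc (fun x => √(Z⁻¹ * Real.exp (-β * x))) H := by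
    rw [hg, ← cfc_comp Real.sqrt (fun x => Z⁻¹ * Real.exp (-β * x)) H
      (show IsSelfAdjoint H from hH)]
    rfl
  refine ⟨U, fun i => Z⁻¹ * Real.exp (-β * hH.eigenvalues i), √Z, hU, fun i => by positivity, ?_,
    ?_, ?_, Real.sqrt_pos.2 hZ0, ?_⟩
  · rw [← Finset.mul_sum, ← hZ, inv_mul_cancel₀ hZ0.ne']
  · rw [hg, cfc_eq_conjDiag hH]
  · rw [hs, cfc_eq_conjDiag hH]
  · rw [hs, exp_smul_eq_cfc hH, cfc_eq_conjDiag hH, cfc_eq_conjDiag hH, smul_conjDiag]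
    congr 1
    ext i
    rw [← Real.sqrt_mul hZ0.le, mul_inv_cancel_left₀ hZ0.ne', Real.sqrt_eq_rpow, ← Real.exp_mul]
    congr 1
    ring

/-! ### Comparison of averages over the sphere -/

theorem norm_act_unitary {D : ℕ} {U : Matrix (Fin D) (Fin D) ℂ} (hU : U.conjTranspose * U = 1)
    (x : Hilb D) : ‖act U x‖ = ‖x‖ := by
  have h : inner ℂ (act U x) (act U x) = inner ℂ x x := by
    have := LinearMap.adjoint_inner_right (Matrix.toEuclideanLin U) x (act U x)
    rw [← Matrix.toEuclideanLin_conjTranspose_eq_adjoint] at this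
    change inner ℂ x (act U.conjTranspose (act U x)) = inner ℂ (act U x) (act U x) at this
    rw [← this, ← act_mul, hU, act_one]
  rw [inner_self_eq_norm_sq_to_K, inner_self_eq_norm_sq_to_K] at h
  have h' : ‖act U x‖ ^ 2 = ‖x‖ ^ 2 := by exact_mod_cast h
  exact (sq_eq_sq₀ (norm_nonneg _) (norm_nonneg _)).1 h'

theorem norm_sq_act_conjDiag_sqrt {D : ℕ} {U : Matrix (Fin D) (Fin D) ℂ}
    (hU : U.conjTranspose * U = 1) {lam : Fin D → ℝ} (h : ∀ i, 0 ≤ lam i) (x : Hilb D) :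
    ‖act (conjDiag U fun i => √(lam i)) x‖ ^ 2 = diagForm lam (act U.conjTranspose x) := by
  rw [conjDiag, act_mul, act_mul, norm_act_unitary hU, EuclideanSpace.norm_sq_eq, diagForm]
  refine Finset.sum_congr rfl fun i _ => ?_
  rw [act_diagonal, norm_mul, mul_pow, Complex.norm_real, Real.norm_eq_abs, sq_abs,
    Real.sq_sqrt (h i)]

theorem re_inner_act_conjDiag {D : ℕ} (U : Matrix (Fin D) (Fin D) ℂ) (lam : Fin D → ℝ)
    (x : Hilb D) :
    (inner ℂ x (act (conjDiag U lam) x)).re = diagForm lam (act U.conjTranspose x) := by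
  have h := LinearMap.adjoint_inner_left (Matrix.toEuclideanLin U)
    (act (Matrix.diagonal fun i => (lam i : ℂ)) (act U.conjTranspose x)) x
  rw [← Matrix.toEuclideanLin_conjTranspose_eq_adjoint] at h
  rw [conjDiag, act_mul, act_mul]
  change inner ℂ (act U.conjTranspose x) _ = inner ℂ x (act U _) at h
  rw [← h, PiLp.inner_apply, Complex.re_sum, diagForm]
  refine Finset.sum_congr rfl fun i _ => ?_
  rw [act_diagonal, ← smul_eq_mul, inner_smul_right, inner_self_eq_norm_sq_to_K,
    Complex.re_ofReal_mul]
  norm_cast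

theorem tensorForm_smul {D k : ℕ} (y : (Fin k → Fin D) → ℂ) (r : ℝ) (z : Hilb D) :
    tensorForm y (r • z) = (r : ℂ) ^ k * tensorForm y z := by
  simp only [tensorForm, Finset.mul_sum]
  refine Finset.sum_congr rfl fun j _ => ?_
  simp only [PiLp.smul_apply, Complex.real_smul, Finset.prod_mul_distrib, Finset.prod_const,
    Finset.card_univ, Fintype.card_fin]
  ring

theorem tensorForm_act {D k : ℕ} (y : (Fin k → Fin D) → ℂ) (B : Matrix (Fin D) (Fin D) ℂ)
    (z : Hilb D) :
    tensorForm y (act B z) = tensorForm (fun j => ∑ i, y i * ∏ a, B (i a) (j a)) z := by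
  simp only [tensorForm, act_apply, Finset.prod_univ_sum, Fintype.piFinset_univ,
    Finset.prod_mul_distrib, Finset.mul_sum, Finset.sum_mul]
  rw [Finset.sum_comm]
  exact Finset.sum_congr rfl fun j _ => Finset.sum_congr rfl fun i _ => (mul_assoc _ _ _).symm

theorem norm_sq_tensorForm_unitVector {D k : ℕ} (y : (Fin k → Fin D) → ℂ) (ψ : Hilb D) :
    ‖tensorForm y (unitVector ψ)‖ ^ 2 = (‖ψ‖ ^ 2)⁻¹ ^ k * ‖tensorForm y ψ‖ ^ 2 := by
  rw [unitVector, tensorForm_smul, norm_mul, mul_pow, norm_pow, Complex.norm_real, norm_inv,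
    norm_norm, ← pow_mul, inv_pow, inv_pow, ← pow_mul, mul_comm k 2]

/-- In the eigenbasis of `R²`, the overlap of `R x / ‖R x‖` with a `k`-fold tensor is a ratio of
homogeneous forms. -/
theorem norm_sq_tensorForm_unitVector_act {D k : ℕ} {U : Matrix (Fin D) (Fin D) ℂ}
    (hU : U.conjTranspose * U = 1) {lam : Fin D → ℝ} (h : ∀ i, 0 ≤ lam i)
    (y : (Fin k → Fin D) → ℂ) :
    ∃ w : (Fin k → Fin D) → ℂ, ∀ x : Hilb D,
      ‖tensorForm y (unitVector (act (conjDiag U fun i => √(lam i)) x))‖ ^ 2 =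
        ratio lam w (act U.conjTranspose x) := by
  refine ⟨fun j => (∏ a, ((√(lam (j a)) : ℝ) : ℂ)) * ∑ i, y i * ∏ a, U (i a) (j a),
    fun x => ?_⟩
  rw [norm_sq_tensorForm_unitVector, norm_sq_act_conjDiag_sqrt hU h, conjDiag, act_mul,
    act_mul, tensorForm_act, tensorForm_act_diagonal]
  rfl

theorem integral_comp_act_conjTranspose {D : ℕ} {U : Matrix (Fin D) (Fin D) ℂ}
    (hU : U.conjTranspose * U = 1) (F : Hilb D → ℝ) :
    ∫ x, F (act U.conjTranspose x) = ∫ z, F z := by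
  have hdet : ‖U.conjTranspose.det‖ = 1 := by
    have h := congrArg (fun A => ‖Matrix.det A‖) hU
    simp only [Matrix.det_mul, norm_mul, Matrix.det_one, norm_one, Matrix.det_conjTranspose,
      norm_star] at h ⊢
    nlinarith [norm_nonneg U.det]
  have h0 : U.conjTranspose.det ≠ 0 := by
    rw [← norm_ne_zero_iff, hdet]; exact one_ne_zero
  rw [integral_comp_act h0, hdet, one_pow, inv_one, one_smul]

/-- The second moment of the standard complex Gaussian vector: the case `k = 0`, `X = ‖z‖²` of the
two comparison inequalities, which then coincide. -/
theorem integral_norm_sq_mul_gaussian (D : ℕ) :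
    ∫ z : Hilb D, ‖z‖ ^ 2 * Real.exp (-‖z‖ ^ 2) = D * ∫ z : Hilb D, Real.exp (-‖z‖ ^ 2) := by
  have h1 := sub_mul_integral_ratio_le (D := D) (k := 0) (lam := fun _ => 1) (s := 1)
    (fun _ => one_pos) zero_le_one (fun _ => le_rfl) (fun _ => 1)
  have h2 := integral_ratio_le_add_mul (D := D) (k := 0) (lam := fun _ => 1) (s := 1)
    (fun _ => one_pos) zero_le_one (fun _ => le_rfl) (fun _ => 1)
  have e : ∀ z : Hilb D, diagForm (fun _ => 1) z = ‖z‖ ^ 2 := fun z => by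
    simp [diagForm, EuclideanSpace.norm_sq_eq]
  simp only [ratio, e, tensorForm] at h1 h2
  simp at h1 h2
  exact le_antisymm h2 h1

/-- For functions homogeneous of degree `0`, passing from the Haar measure to the measure with
density `D X` changes integrals of squared moduli of forms by a factor between `1 - k s` and
`1 + k s`. -/
theorem haarSphere_ratio_bounds {D k : ℕ} [NeZero D] {U : Matrix (Fin D) (Fin D) ℂ}
    (hU : U.conjTranspose * U = 1) {lam : Fin D → ℝ} (h : ∀ i, 0 < lam i)
    (hsum : ∑ i, lam i = 1) {s : ℝ} (hs0 : 0 ≤ s) (hs : ∀ i, lam i ≤ s)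
    (w : (Fin k → Fin D) → ℂ) {q : Hilb D → ℝ} (hq : ∀ x, q x = ratio lam w (act U.conjTranspose x))
    (hq1 : ∀ x, q (unitVector x) = q x) :
    (1 - k * s) * ∫ φ, q φ ∂haarSphere D ≤
        ∫ φ, D * diagForm lam (act U.conjTranspose (φ : Hilb D)) * q φ ∂haarSphere D ∧
      ∫ φ, D * diagForm lam (act U.conjTranspose (φ : Hilb D)) * q φ ∂haarSphere D ≤
        (1 + k * s) * ∫ φ, q φ ∂haarSphere D := by
  set τ := (volume : Measure (Hilb D)).toSphere with hτ
  set ν := Measure.volumeIoiPow (Module.finrank ℝ (Hilb D) - 1) with hν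
  set g : Hilb D → ℝ := fun x => diagForm lam (act U.conjTranspose x) with hg
  set A₀ : ℝ := ∫ r : Set.Ioi (0 : ℝ), Real.exp (-(r : ℝ) ^ 2) ∂ν with hA₀
  set A₁ : ℝ := ∫ r : Set.Ioi (0 : ℝ), (r : ℝ) ^ 2 * Real.exp (-(r : ℝ) ^ 2) ∂ν with hA₁
  set J₀ := ∫ z, ratio lam w z * Real.exp (-‖z‖ ^ 2) with hJ₀
  set J₁ := ∫ z, ratio lam w z * (diagForm lam z * Real.exp (-‖z‖ ^ 2)) with hJ₁
  have hU' : U * U.conjTranspose = 1 := mul_eq_one_comm.1 hU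
  have hnorm : ∀ x, ‖act U.conjTranspose x‖ = ‖x‖ := norm_act_unitary (by
    rwa [Matrix.conjTranspose_conjTranspose])
  have hgs : ∀ x, g (unitVector x) * ‖x‖ ^ 2 = g x := fun x => by
    rcases eq_or_ne x 0 with rfl | hx
    · simp [hg, diagForm, act_apply]
    · have hx' := norm_ne_zero_iff.2 hx
      have e : ∀ (r : ℝ) (z : Hilb D), diagForm lam (r • z) = r ^ 2 * diagForm lam z :=
        fun r z => by
          simp only [diagForm, Finset.mul_sum, PiLp.smul_apply, norm_smul, mul_pow,
            Real.norm_eq_abs, sq_abs]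
          exact Finset.sum_congr rfl fun i _ => by ring
      simp only [hg, unitVector, act_smul_real, e]
      field_simp
  have hp0 : (∫ φ, q φ ∂τ) * A₀ = J₀ := by
    rw [hA₀, ← integral_polar q fun r => Real.exp (-r ^ 2), hJ₀,
      ← integral_comp_act_conjTranspose hU fun z => ratio lam w z * Real.exp (-‖z‖ ^ 2)]
    exact integral_congr_ae (Filter.Eventually.of_forall fun x => by
      simp only [hq1, hq, hnorm])
  have hp1 : (∫ φ, g φ * q φ ∂τ) * A₁ = J₁ := by
    rw [hA₁, ← integral_polar (fun x => g x * q x) fun r => r ^ 2 * Real.exp (-r ^ 2), hJ₁,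
      ← integral_comp_act_conjTranspose hU fun z =>
        ratio lam w z * (diagForm lam z * Real.exp (-‖z‖ ^ 2))]
    refine integral_congr_ae (Filter.Eventually.of_forall fun x => ?_)
    simp only [hq1, ← hq, hnorm]
    have := hgs x
    simp only [hg] at this ⊢
    linear_combination (q x * Real.exp (-‖x‖ ^ 2)) * this
  have ht0 : 0 < τ.real Set.univ :=
    ENNReal.toReal_pos (toSphere_univ_ne_zero D) (measure_ne_top _ _)
  have hm0 : τ.real Set.univ * A₀ = ∫ z : Hilb D, Real.exp (-‖z‖ ^ 2) := by
    have := integral_polar (D := D) (fun _ => 1) fun r => Real.exp (-r ^ 2)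
    simpa [← hτ, ← hν, ← hA₀] using this.symm
  have hm1 : τ.real Set.univ * A₁ = ∫ z : Hilb D, ‖z‖ ^ 2 * Real.exp (-‖z‖ ^ 2) := by
    have := integral_polar (D := D) (fun _ => 1) fun r => r ^ 2 * Real.exp (-r ^ 2)
    simpa [← hτ, ← hν, ← hA₁] using this.symm
  have hA₀0 : 0 < A₀ := by
    have hi := integrable_exp_neg_mul_norm_sq (D := D) one_pos
    simp only [neg_one_mul] at hi
    have := integral_exp_pos hi
    rw [← hm0] at this
    exact pos_of_mul_pos_right this ht0.le
  have hA₁0 : A₁ = D * A₀ := by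
    have := integral_norm_sq_mul_gaussian D
    rw [← hm0, ← hm1] at this
    have h2 : τ.real Set.univ * A₁ = τ.real Set.univ * (D * A₀) := by linarith
    exact mul_left_cancel₀ ht0.ne' h2
  have hlow := sub_mul_integral_ratio_le h hs0 hs w
  have hupp := integral_ratio_le_add_mul h hs0 hs w
  rw [hsum, ← hJ₀, ← hJ₁, ← hp0, ← hp1, hA₁0] at hlow hupp
  have hh : ∀ f : Metric.sphere (0 : Hilb D) 1 → ℝ,
      ∫ φ, f φ ∂haarSphere D = (τ.real Set.univ)⁻¹ * ∫ φ, f φ ∂τ := fun f => by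
    rw [haarSphere, integral_smul_measure, ENNReal.toReal_inv, smul_eq_mul]; rfl
  have e1 : ∫ φ, D * g φ * q φ ∂τ = D * ∫ φ, g φ * q φ ∂τ := by
    rw [← integral_const_mul]
    simp only [mul_assoc]
  rw [hh, hh]
  change _ ≤ _ * ∫ φ, D * g φ * q φ ∂τ ∧ _ * ∫ φ, D * g φ * q φ ∂τ ≤ _
  rw [e1]
  have ht := (inv_pos.2 ht0).le
  constructor
  · have : (1 - k * s) * ∫ φ, q φ ∂τ ≤ D * ∫ φ, g φ * q φ ∂τ :=
      le_of_mul_le_mul_right (by linarith) hA₀0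
    have := mul_le_mul_of_nonneg_left this ht
    linarith
  · have : D * ∫ φ, g φ * q φ ∂τ ≤ (1 + k * s) * ∫ φ, q φ ∂τ :=
      le_of_mul_le_mul_right (by linarith) hA₀0
    have := mul_le_mul_of_nonneg_left this ht
    linarith

/-! ### Moments of pure state ensembles -/

/-- The quadratic form of the `k`-th moment is the mean squared overlap with a `k`-fold tensor. -/
theorem star_dotProduct_moment_mulVec {D k : ℕ} {E : Measure (Hilb D)} [IsFiniteMeasure E]
    (hE : ∀ᵐ ψ ∂E, ‖ψ‖ = 1) (x : (Fin k → Fin D) → ℂ) :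
    star x ⬝ᵥ (moment k E).mulVec x = ((∫ ψ, ‖tensorForm (star x) ψ‖ ^ 2 ∂E : ℝ) : ℂ) := by
  have hint : ∀ i j : Fin k → Fin D,
      Integrable (fun ψ : Hilb D => (∏ a, ψ (i a)) * star (∏ a, ψ (j a))) E := fun i j => by
    refine Integrable.of_bound (C := 1) ((measurable_prod_coord (D := D) i).mul
      (continuous_star.measurable.comp (measurable_prod_coord (D := D) j))).aestronglyMeasurable ?_
    filter_upwards [hE] with ψ hψ
    rw [norm_mul, norm_star]
    have hi := norm_prod_coord_le ψ i
    have hj := norm_prod_coord_le ψ j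
    rw [hψ, one_pow] at hi hj
    exact mul_le_one₀ hi (norm_nonneg _) hj
  have hm : ∀ i j, moment k E i j =
      ∫ ψ, (∏ a, ψ (i a)) * star (∏ a, ψ (j a)) ∂E := fun i j => by
    simp only [moment, projTensor, Finset.prod_mul_distrib, star_prod]
  rw [← integral_complex_ofReal]
  simp_rw [norm_sq_tensorForm]
  rw [integral_finsetSum _ fun i _ => integrable_finsetSum _ fun j _ => (hint i j).const_mul _]
  refine Finset.sum_congr rfl fun i _ => ?_
  rw [integral_finsetSum _ fun j _ => (hint i j).const_mul _, Matrix.mulVec, dotProduct,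
    Finset.mul_sum]
  refine Finset.sum_congr rfl fun j _ => ?_
  rw [integral_const_mul, hm, Pi.star_apply, Pi.star_apply, star_star]
  ring

theorem isHermitian_moment {D : ℕ} (k : ℕ) (E : Measure (Hilb D)) :
    (moment k E).IsHermitian := by
  ext i j
  rw [Matrix.conjTranspose_apply, moment, moment, Complex.star_def, ← integral_conj]
  refine integral_congr_ae (Filter.Eventually.of_forall fun ψ => ?_)
  simp only [projTensor, map_prod, map_mul, Complex.star_def, Complex.conj_conj, mul_comm]

/-- The Loewner order on moments, tested on mean squared overlaps. -/
theorem posSemidef_smul_moment_sub {D k : ℕ} {E F : Measure (Hilb D)} [IsFiniteMeasure E]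
    [IsFiniteMeasure F] (hE : ∀ᵐ ψ ∂E, ‖ψ‖ = 1) (hF : ∀ᵐ ψ ∂F, ‖ψ‖ = 1) (a b : ℝ)
    (h : ∀ y : (Fin k → Fin D) → ℂ, b * ∫ ψ, ‖tensorForm y ψ‖ ^ 2 ∂F ≤
      a * ∫ ψ, ‖tensorForm y ψ‖ ^ 2 ∂E) :
    (a • moment k E - b • moment k F).PosSemidef := by
  refine .of_dotProduct_mulVec_nonneg ?_ fun x => ?_
  · exact ((isHermitian_moment k E).smul (IsSelfAdjoint.all a)).sub
      ((isHermitian_moment k F).smul (IsSelfAdjoint.all b))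
  · rw [Matrix.sub_mulVec, dotProduct_sub, Matrix.smul_mulVec, Matrix.smul_mulVec,
      dotProduct_smul, dotProduct_smul, star_dotProduct_moment_mulVec hE,
      star_dotProduct_moment_mulVec hF, Complex.real_smul, Complex.real_smul,
      ← Complex.ofReal_mul, ← Complex.ofReal_mul, ← Complex.ofReal_sub, Complex.zero_le_real,
      sub_nonneg]
    exact h _

theorem unitVector_act_unitVector {D : ℕ} (R : Matrix (Fin D) (Fin D) ℂ) (x : Hilb D) :
    unitVector (act R (unitVector x)) = unitVector (act R x) := by
  rcases eq_or_ne x 0 with rfl | hx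
  · simp [unitVector]
  · rw [unitVector.eq_1 x, act_smul_real, unitVector_smul (inv_pos.2 (norm_pos_iff.2 hx))]

/-- The canonical thermal pure quantum ensemble is the image of the Haar measure under
`φ ↦ √σ φ / ‖√σ φ‖`: the direction of the Gaussian vector is Haar distributed, and scalar factors
are removed by normalization. -/
theorem cTPQ_eq_map_haarSphere {D : ℕ} [NeZero D] {H R : Matrix (Fin D) (Fin D) ℂ} {β c : ℝ}
    (hc : 0 < c) (hR : NormedSpace.exp ((-β / 2) • H) = c • R) {v : ℝ≥0} (hv : v ≠ 0)
    (b : OrthonormalBasis (Fin D) ℂ (Hilb D)) :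
    cTPQ H β v b =
      (haarSphere D).map fun φ : Metric.sphere (0 : Hilb D) 1 => unitVector (act R φ) := by
  have hm : Measurable fun x : Hilb D => unitVector (act R x) :=
    measurable_unitVector.comp (continuous_act R).measurable
  have hfun : (fun ξ : Fin D → ℂ =>
        unitVector (∑ j, ξ j • act (NormedSpace.exp ((-β / 2) • H)) (b j))) =
      (fun x => unitVector (act R x)) ∘ fun ξ => unitVector (∑ j, ξ j • b j) := by
    ext1 ξ
    have h1 : ∑ j, ξ j • act (NormedSpace.exp ((-β / 2) • H)) (b j) =
        act (NormedSpace.exp ((-β / 2) • H)) (∑ j, ξ j • b j) := by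
      simp only [act, map_sum, map_smul]
    have h2 : ∀ x : Hilb D, act (c • R) x = c • act R x := fun x => by
      ext i
      simp [act_apply, Finset.mul_sum, mul_assoc]
    rw [Function.comp_apply, unitVector_act_unitVector, h1, hR, h2, unitVector_smul hc]
  have hg : Measurable fun ξ : Fin D → ℂ => unitVector (∑ j, ξ j • b j) :=
    measurable_unitVector.comp (Finset.measurable_sum _ fun j _ =>
      (measurable_pi_apply j).smul_const _)
  rw [cTPQ, hfun, ← Measure.map_map hm hg, map_unitVector_gaussian hv b,
    Measure.map_map hm measurable_subtype_coe]
  rfl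

end Scrooge

theorem mainTheorem7 :
    ∃ c : ℝ, 0 < c ∧ ∃ C : ℝ, 0 < C ∧ ∃ K : ℕ → ℝ,
      ∀ (D k : ℕ), 0 < D →
      ∀ (H : Matrix (Fin D) (Fin D) ℂ), H.IsHermitian →
      ∀ (β : ℝ) (v : ℝ≥0), v ≠ 0 →
      ∀ (b : OrthonormalBasis (Fin D) ℂ (Scrooge.Hilb D)),
        (k : ℝ) ^ 2 * Scrooge.schattenTwo (Scrooge.gibbs H β) ≤ c →
        ∃ ε δ : ℝ,
          1 + ε = (1 + δ) ^ 2 ∧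
          0 ≤ δ ∧ δ ≤ C * (4 ^ k * k * Scrooge.schattenTwo (Scrooge.gibbs H β)) ∧
          ε ≤ K k * (4 ^ k * k * Scrooge.schattenTwo (Scrooge.gibbs H β)) ∧
          Scrooge.IsRelScroogeDesign k (Scrooge.gibbs H β) ε (Scrooge.cTPQ H β v b) := by
  refine ⟨1 / 2, by norm_num, 2, by norm_num, fun _ => 6, ?_⟩
  intro D k hD H hH β v hv b hks
  have : NeZero D := ⟨hD.ne'⟩
  obtain ⟨U, lam, c, hU, hlam, hsum, hg, hsq, hc, hexp⟩ := Scrooge.exists_gibbs_spectral hH β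
  set s := Scrooge.schattenTwo (Scrooge.gibbs H β) with hs
  have hs0 : 0 ≤ s := Real.sqrt_nonneg _
  have hls : ∀ i, lam i ≤ s := fun i => by
    rw [hs, hg, Scrooge.schattenTwo_conjDiag hU]
    refine Real.le_sqrt_of_sq_le ?_
    exact Finset.single_le_sum (f := fun i => lam i ^ 2) (fun i _ => sq_nonneg _)
      (Finset.mem_univ i)
  set a : ℝ := k * s with ha
  have ha0 : 0 ≤ a := by positivity
  have ha2 : a ≤ 1 / 2 := by
    refine le_trans ?_ hks
    rw [ha]
    refine mul_le_mul_of_nonneg_right ?_ hs0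
    exact_mod_cast Nat.le_self_pow two_ne_zero k
  have ha4 : a ≤ 4 ^ k * k * s := by
    rw [mul_assoc, ← ha]
    exact le_mul_of_one_le_left ha0 (one_le_pow₀ (by norm_num))
  refine ⟨(1 + 2 * a) ^ 2 - 1, 2 * a, by ring, by positivity, by linarith, by nlinarith, ?_⟩
  -- with `a = k s`, the error `ε = (1 + 2 a)² - 1 ≥ 2 a` dominates that of inverting `1 ± a`
  set R := cfc Real.sqrt (Scrooge.gibbs H β) with hR
  set T : Metric.sphere (0 : Scrooge.Hilb D) 1 → Scrooge.Hilb D :=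
    fun φ => Scrooge.unitVector (Scrooge.act R φ) with hT
  have hTm : Measurable T := Scrooge.measurable_unitVector.comp
    ((Scrooge.continuous_act R).measurable.comp measurable_subtype_coe)
  have hT1 : ∀ φ, ‖T φ‖ = 1 := fun φ => by
    refine Scrooge.norm_unitVector fun h0 => ?_
    obtain ⟨m, hm, hml⟩ := Scrooge.exists_pos_forall_le hlam
    have h1 := Scrooge.norm_sq_act_conjDiag_sqrt hU (fun i => (hlam i).le) (φ : Scrooge.Hilb D)
    have h2 := Scrooge.mul_norm_sq_le_diagForm hml (Scrooge.act U.conjTranspose φ)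
    have hU' : U.conjTranspose.conjTranspose * U.conjTranspose = 1 := by
      rw [Matrix.conjTranspose_conjTranspose]; exact mul_eq_one_comm.1 hU
    rw [← h1, ← hsq, h0, Scrooge.norm_act_unitary hU', norm_eq_of_mem_sphere φ] at h2
    norm_num at h2
    linarith
  have hX : ∀ φ : Scrooge.Hilb D, (inner ℂ φ (Scrooge.act (Scrooge.gibbs H β) φ)).re =
      Scrooge.diagForm lam (Scrooge.act U.conjTranspose φ) := fun φ => by
    rw [hg]; exact Scrooge.re_inner_act_conjDiag U lam φ
  have hX0 : ∀ φ : Scrooge.Hilb D,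
      0 ≤ D * Scrooge.diagForm lam (Scrooge.act U.conjTranspose φ) := fun φ =>
    mul_nonneg (Nat.cast_nonneg D) (Scrooge.diagForm_nonneg (fun i => (hlam i).le) _)
  have hXc : Continuous fun φ : Metric.sphere (0 : Scrooge.Hilb D) 1 =>
      D * Scrooge.diagForm lam (Scrooge.act U.conjTranspose φ) :=
    continuous_const.mul ((Scrooge.continuous_diagForm lam).comp
      ((Scrooge.continuous_act _).comp continuous_subtype_val))
  set W : Measure (Metric.sphere (0 : Scrooge.Hilb D) 1) :=
    (Scrooge.haarSphere D).withDensity fun φ => ENNReal.ofReal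
      (D * Scrooge.diagForm lam (Scrooge.act U.conjTranspose φ)) with hW
  have hWfin : IsFiniteMeasure W := isFiniteMeasure_withDensity_ofReal
    (hXc.integrable_of_hasCompactSupport (HasCompactSupport.of_compactSpace _)).2
  have hS : Scrooge.scroogeEnsemble (Scrooge.gibbs H β) = W.map T := by
    simp only [Scrooge.scroogeEnsemble, hX, hW, hT, hR]
  have hE : Scrooge.cTPQ H β v b = (Scrooge.haarSphere D).map T :=
    Scrooge.cTPQ_eq_map_haarSphere hc hexp hv b
  have hEp : IsProbabilityMeasure ((Scrooge.haarSphere D).map T) :=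
    Measure.isProbabilityMeasure_map hTm.aemeasurable
  have hns : MeasurableSet {ψ : Scrooge.Hilb D | ‖ψ‖ = 1} :=
    measurableSet_eq_fun measurable_norm measurable_const
  have hE1 : ∀ᵐ ψ ∂(Scrooge.haarSphere D).map T, ‖ψ‖ = 1 :=
    (ae_map_iff hTm.aemeasurable hns).2 (Filter.Eventually.of_forall hT1)
  have hS1 : ∀ᵐ ψ ∂W.map T, ‖ψ‖ = 1 :=
    (ae_map_iff hTm.aemeasurable hns).2 (Filter.Eventually.of_forall hT1)
  have key : ∀ y : (Fin k → Fin D) → ℂ,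
      0 ≤ ∫ ψ, ‖Scrooge.tensorForm y ψ‖ ^ 2 ∂(Scrooge.haarSphere D).map T ∧
      (1 - a) * ∫ ψ, ‖Scrooge.tensorForm y ψ‖ ^ 2 ∂(Scrooge.haarSphere D).map T ≤
        ∫ ψ, ‖Scrooge.tensorForm y ψ‖ ^ 2 ∂W.map T ∧
      ∫ ψ, ‖Scrooge.tensorForm y ψ‖ ^ 2 ∂W.map T ≤
        (1 + a) * ∫ ψ, ‖Scrooge.tensorForm y ψ‖ ^ 2 ∂(Scrooge.haarSphere D).map T := by
    intro y
    refine ⟨integral_nonneg fun ψ => sq_nonneg _, ?_⟩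
    obtain ⟨w, hw⟩ := Scrooge.norm_sq_tensorForm_unitVector_act hU (fun i => (hlam i).le) y
    rw [← hsq] at hw
    have hm : Measurable fun ψ : Scrooge.Hilb D => ‖Scrooge.tensorForm y ψ‖ ^ 2 := by fun_prop
    rw [integral_map hTm.aemeasurable hm.aestronglyMeasurable,
      integral_map hTm.aemeasurable hm.aestronglyMeasurable, hW,
      integral_withDensity_eq_integral_toReal_smul hXc.measurable.ennreal_ofReal
        (Filter.Eventually.of_forall fun _ => ENNReal.ofReal_lt_top)]
    simp only [ENNReal.toReal_ofReal (hX0 _), smul_eq_mul]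
    refine Scrooge.haarSphere_ratio_bounds hU hlam hsum hs0 hls w
      (q := fun x => ‖Scrooge.tensorForm y (Scrooge.unitVector (Scrooge.act R x))‖ ^ 2) hw
      fun x => ?_
    simp only [Scrooge.unitVector_act_unitVector]
  rw [Scrooge.IsRelScroogeDesign, hE, hS]
  refine ⟨⟨hEp, hE1⟩, ?_, ?_⟩
  · have := Scrooge.posSemidef_smul_moment_sub (k := k) hE1 hS1 1 (1 - ((1 + 2 * a) ^ 2 - 1))
      fun y => by
        obtain ⟨h0, h1, h2⟩ := key y
        have h3 : 0 ≤ ∫ ψ, ‖Scrooge.tensorForm y ψ‖ ^ 2 ∂W.map T :=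
          (mul_nonneg (by linarith) h0).trans h1
        calc _ ≤ (1 - a) * ∫ ψ, ‖Scrooge.tensorForm y ψ‖ ^ 2 ∂W.map T :=
              mul_le_mul_of_nonneg_right (by nlinarith) h3
          _ ≤ (1 - a) * ((1 + a) * _) := mul_le_mul_of_nonneg_left h2 (by linarith)
          _ ≤ _ := by
            rw [← mul_assoc]
            exact mul_le_mul_of_nonneg_right (by nlinarith) h0
    rwa [one_smul] at this
  · have := Scrooge.posSemidef_smul_moment_sub (k := k) hS1 hE1 (1 + ((1 + 2 * a) ^ 2 - 1)) 1
      fun y => by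
        obtain ⟨h0, h1, h2⟩ := key y
        calc _ ≤ (1 + ((1 + 2 * a) ^ 2 - 1)) * ((1 - a) * _) := by
              rw [← mul_assoc]
              exact mul_le_mul_of_nonneg_right (by nlinarith [mul_nonneg ha0 ha0]) h0
          _ ≤ _ := mul_le_mul_of_nonneg_left h1 (by nlinarith)
    rwa [one_smul] at this
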